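/- A simplicial complex on $n$ vertices is a finite abstract simplicial complex with exactly $n$ vertices; the empty complex, with $n = 0$, is allowed. For an integer $d \ge 2$ and a finite abelian group $G$, let $T^d(G)$ be the minimum number $n$ of vertices of a simplicial complex $X$ on $n$ vertices with $H^d(X) \cong G$, where $H^d(X) = H^d(X;\mathbb{Z})$ is the $d$-th simplicial cohomology group of $X$ with integer coefficients. **Theorem.** For every integer $d \ge 2$ there are constants $c_d > 0$ and $C_d > 0$, depending only on $d$, such that for every finite abelian group $G$ there is a simplicial complex $X$ with $H^d(X) \cong G$ (so that $T^d(G)$ is well defined), and $$c_d\,(\log|G|)^{1/d} \;\le\; T^d(G) \;\le\; C_d\,(\log|G|)^{1/d},$$ where $\log$ is the natural logarithm. -/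

import Mathlib

namespace AbstractSimplicialComplex

/-- The `k`-dimensional faces of a simplicial complex: the faces with `k + 1` vertices. -/
def Face {V : Type*} (X : AbstractSimplicialComplex V) (k : ℕ) : Type _ :=
  {s : Finset V // s ∈ X.faces ∧ s.card = k + 1}

namespace Face

variable {V : Type*} [LinearOrder V] {X : AbstractSimplicialComplex V} {k : ℕ}

/-- The `k`-dimensional face obtained from a `(k + 1)`-dimensional face by deleting a vertex. -/
def delete (s : X.Face (k + 1)) (v : V) (hv : v ∈ s.1) : X.Face k :=
  ⟨s.1.erase v, by
    have hc : (s.1.erase v).card = k + 1 := by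
      rw [Finset.card_erase_of_mem hv, s.2.2]; rfl
    exact ⟨(X.isRelLowerSet_faces s.2.1).2 (Finset.erase_subset v s.1)
      (Finset.card_pos.mp (by omega)), hc⟩⟩

/-- The incidence sign `(-1) ^ i`, where `v` is the `i`-th vertex (counted from `0`) of the
face `s` in increasing order. -/
def sign (s : X.Face k) (v : V) : ℤ :=
  (-1) ^ (s.1.filter (fun w => w < v)).card

end Face

variable {V : Type*} [LinearOrder V]

/-- Integral simplicial `k`-cochains, each face being oriented by the order of the vertices. -/
abbrev Cochain (X : AbstractSimplicialComplex V) (k : ℕ) : Type _ :=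
  X.Face k → ℤ

/-- The simplicial coboundary operator
`(δ f) [v₀, …, v_{k+1}] = ∑ i, (-1) ^ i * f [v₀, …, v̂ᵢ, …, v_{k+1}]` for `v₀ < ⋯ < v_{k+1}`. -/
def coboundary (X : AbstractSimplicialComplex V) (k : ℕ) : X.Cochain k →ₗ[ℤ] X.Cochain (k + 1) where
  toFun f := fun s => ∑ v ∈ s.1.attach, s.sign v.1 * f (s.delete v.1 v.2)
  map_add' f g := by
    funext s
    simp [mul_add, Finset.sum_add_distrib]
  map_smul' a f := by
    funext s
    simp [Finset.mul_sum, mul_left_comm]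

/-- The integral `k`-cocycles. -/
def cocycles (X : AbstractSimplicialComplex V) (k : ℕ) : Submodule ℤ (X.Cochain k) :=
  LinearMap.ker (X.coboundary k)

/-- The integral `k`-coboundaries (there are none but `0` in degree `0`: the cochain complex
is not augmented). -/
def coboundaries (X : AbstractSimplicialComplex V) : (k : ℕ) → Submodule ℤ (X.Cochain k)
  | 0 => ⊥
  | k + 1 => LinearMap.range (X.coboundary k)

theorem Face.sign_mul_sign_delete {X : AbstractSimplicialComplex V} {k : ℕ} (s : X.Face (k + 1))
    {v w : V} (hv : v ∈ s.1) (h : v < w) :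
    s.sign w = - (s.delete v hv).sign w := by
  have h1 : s.1.filter (fun x => x < w) =
      insert v ((s.1.erase v).filter (fun x => x < w)) := by
    ext x; simp only [Finset.mem_filter, Finset.mem_insert, Finset.mem_erase]; grind
  have h2 : v ∉ (s.1.erase v).filter (fun x => x < w) := by simp
  simp only [Face.sign, Face.delete]
  rw [h1, Finset.card_insert_of_notMem h2, pow_succ]; ring

theorem Face.sign_delete_of_lt {X : AbstractSimplicialComplex V} {k : ℕ} (s : X.Face (k + 1))
    {v w : V} (hv : v ∈ s.1) (h : w < v) :
    (s.delete v hv).sign w = s.sign w := by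
  have h1 : s.1.filter (fun x => x < w) = (s.1.erase v).filter (fun x => x < w) := by
    ext x; simp only [Finset.mem_filter, Finset.mem_erase]; grind
  simp only [Face.sign, Face.delete]
  rw [h1]

theorem coboundary_coboundary (X : AbstractSimplicialComplex V) (k : ℕ) (f : X.Cochain k) :
    X.coboundary (k + 1) (X.coboundary k f) = 0 := by
  funext s
  simp only [coboundary, LinearMap.coe_mk, AddHom.coe_mk, Pi.zero_apply, Finset.mul_sum]
  rw [Finset.sum_sigma']
  refine Finset.sum_involution
    (fun p _ => ⟨⟨p.2.1, Finset.mem_of_mem_erase p.2.2⟩, ⟨p.1.1, Finset.mem_erase.2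
      ⟨(Finset.ne_of_mem_erase p.2.2).symm, p.1.2⟩⟩⟩) ?_ ?_ ?_ ?_
  · rintro ⟨⟨v, hv⟩, ⟨w, hw⟩⟩ -
    have hne : w ≠ v := Finset.ne_of_mem_erase hw
    have hw' : w ∈ s.1 := Finset.mem_of_mem_erase hw
    have hv' : v ∈ s.1.erase w := Finset.mem_erase.2 ⟨hne.symm, hv⟩
    have hd : (s.delete v hv).delete w hw = (s.delete w hw').delete v hv' :=
      Subtype.ext (Finset.erase_right_comm)
    simp only [hd]
    rcases lt_or_gt_of_ne hne with h | h
    · rw [s.sign_delete_of_lt hv h, s.sign_mul_sign_delete hw' h]; ring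
    · rw [s.sign_delete_of_lt hw' h, s.sign_mul_sign_delete hv h]; ring
  · rintro ⟨⟨v, hv⟩, ⟨w, hw⟩⟩ - - h
    have := congrArg (fun p => p.1.1) h
    exact Finset.ne_of_mem_erase hw this
  · intros; simp
  · intros; rfl

/-- Every coboundary is a cocycle. -/
theorem coboundaries_le_cocycles (X : AbstractSimplicialComplex V) (k : ℕ) :
    X.coboundaries k ≤ X.cocycles k := by
  cases k with
  | zero => exact bot_le
  | succ k =>
    rintro _ ⟨f, rfl⟩
    exact X.coboundary_coboundary k f

/-- The `k`-th simplicial cohomology group `H^k(X) = H^k(X; ℤ)`. -/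
abbrev Cohomology (X : AbstractSimplicialComplex V) (k : ℕ) : Type _ :=
  X.cocycles k ⧸ (X.coboundaries k).submoduleOf (X.cocycles k)

end AbstractSimplicialComplex

/-- The set of all `n` such that some simplicial complex `X` on exactly `n` vertices has
`H^d(X) ≅ G`. -/
def cohomologyVertexCounts (d : ℕ) (G : Type*) [AddCommGroup G] : Set ℕ :=
  {n | ∃ X : AbstractSimplicialComplex (Fin n), Nonempty (X.Cohomology d ≃+ G)}

/-- `T^d(G)`: the minimum number of vertices of a simplicial complex `X` with `H^d(X) ≅ G`. -/
noncomputable def cohomologyVertexNumber (d : ℕ) (G : Type*) [AddCommGroup G] : ℕ :=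
  sInf (cohomologyVertexCounts d G)

/-! Lower bound. A finite `H^d(X)` is a subquotient `K / im φ` of a lattice, where `φ` is the
coboundary from degree `d - 1`: it has at most `n ^ d` columns, and each row has `ℓ¹`-norm `d + 1`.
Every class has a representative with coordinates in `[-(d + 1), d + 1]`, and at most `n ^ d`
coordinates separate classes. Hence `|G| ≤ (2 * d + 3) ^ n ^ d` (`card_quotient_range_le`,
`card_cohomology_le`).

Upper bound. Take all sets of at most `d` vertices, some `d`-faces missing an apex, and the cones
over all `d`-sets missing the apex except chosen ones. A `(d - 1)`-face with a cone only eliminates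
the generator of that cone, and each chosen set imposes that the signed sum of the `d`-faces
containing it vanishes (`ConeData.nonempty_cohomology_equiv`). If the vertices are pairs (position,
label) ordered by position, then `d`-faces are tuples, chosen sets are tuples with a hole, and the
signs within a relation agree. So `G` has to be presented by tuples of length `d + 1` over an
alphabet of size `O((log |G|) ^ (1 / d))`.

Repeated doubling along the binary digits of `m` presents `ZMod m` with `O(log m)` generators and
short relations. These generators are the nodes of a network. An arc is a path of tuples that differ
in one position at a time, so that a relation between two consecutive tuples makes them opposite,
and one relation at a node adds up all incoming paths (`LabelledNetwork.exists_cohomology_equiv`).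
The danger is that a hole is also filled by unintended tuples. To exclude this, each entry carries
the letter of its node, which shows how far a path has advanced, and the node's time is written in
base `q` with a check digit, so that it survives the loss of one coordinate. The `d` free digits
give `q ^ d` times with only `O(q)` labels, which is where the exponent `1 / d` comes from. -/

/-! ### Lower bound: the order of a finite subquotient of a lattice -/

/-- The image of an integer matrix is separated by at most as many coordinates as there are
columns. -/
theorem exists_separating_coordinates {a b : Type*} [Fintype a] [DecidableEq a] [Fintype b]
    (φ : (a → ℤ) →ₗ[ℤ] (b → ℤ)) :
    ∃ I : Finset b, I.card ≤ Fintype.card a ∧ ∀ c, (∀ i ∈ I, φ c i = 0) → φ c = 0 := by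
  classical
  let ρ : b → (a → ℚ) := fun i j => (φ (Pi.single j 1) i : ℚ)
  have hφ : ∀ c i, (φ c i : ℚ) = ∑ j, (c j : ℚ) * ρ i j := by
    intro c i
    have hc : c = ∑ j, c j • Pi.single j (1 : ℤ) := by
      funext j
      simp [Finset.sum_apply, Pi.single_apply]
    conv_lhs => rw [hc]
    simp only [ρ, map_sum, map_smul, Finset.sum_apply, Pi.smul_apply, smul_eq_mul]
    push_cast
    rfl
  -- Among the rows, choose a basis of the row space; it has at most as many elements as there are
  -- columns. A functional vanishing on it vanishes on all rows.
  obtain ⟨κ, e, he, hspan, hli⟩ := exists_linearIndependent' ℚ ρ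
  have : Finite κ := Finite.of_injective e he
  have : Fintype κ := Fintype.ofFinite κ
  refine ⟨Finset.univ.image e, ?_, ?_⟩
  · refine Finset.card_image_le.trans ?_
    have := hli.fintype_card_le_finrank
    simpa using this
  · intro c hc
    let L : (a → ℚ) →ₗ[ℚ] ℚ := ∑ j, (c j : ℚ) • LinearMap.proj j
    have hL : ∀ i, L (ρ i) = φ c i := by
      intro i
      rw [hφ]
      simp [L]
    have h1 : Submodule.span ℚ (Set.range ρ) ≤ LinearMap.ker L := by
      rw [← hspan, Submodule.span_le]
      rintro _ ⟨k, rfl⟩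
      have := hc (e k) (Finset.mem_image_of_mem _ (Finset.mem_univ _))
      simp [hL, this]
    funext i
    have h2 : L (ρ i) = 0 := h1 (Submodule.subset_span ⟨i, rfl⟩)
    rw [hL] at h2
    exact_mod_cast h2

/-- A finite subquotient `K / im φ` of `ℤ^b`, where the rows of the integer matrix `φ` have
`ℓ¹`-norm at most `D`, has order at most `(2 * D + 1) ^ a`. -/
theorem card_quotient_range_le {a b : Type*} [Fintype a] [DecidableEq a] [Fintype b]
    (φ : (a → ℤ) →ₗ[ℤ] (b → ℤ)) (K : Submodule ℤ (b → ℤ)) (hle : LinearMap.range φ ≤ K)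
    (D : ℕ)
    (hD : ∀ (c : a → ℤ) (M : ℤ), (∀ j, |c j| ≤ M) → ∀ i, |φ c i| ≤ D * M)
    [Finite (K ⧸ (LinearMap.range φ).submoduleOf K)] :
    Nat.card (K ⧸ (LinearMap.range φ).submoduleOf K) ≤ (2 * D + 1) ^ Fintype.card a := by
  classical
  set N := Nat.card (K ⧸ (LinearMap.range φ).submoduleOf K) with hN
  have hN0 : 0 < N := Nat.card_pos
  have hmul : ∀ x : K, ∃ c, φ c = (N : ℤ) • (x : b → ℤ) := by
    intro x
    have h : N • ((LinearMap.range φ).submoduleOf K).mkQ x = 0 := card_nsmul_eq_zero'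
    rw [← map_nsmul, Submodule.mkQ_apply, Submodule.Quotient.mk_eq_zero,
      Submodule.submoduleOf, Submodule.mem_comap] at h
    obtain ⟨c, hc⟩ := h
    exact ⟨c, by rw [hc]; simp⟩
  obtain ⟨I, hI, hsep⟩ := exists_separating_coordinates φ
  have hrep : ∀ z : K ⧸ (LinearMap.range φ).submoduleOf K,
      ∃ x : K, ((LinearMap.range φ).submoduleOf K).mkQ x = z ∧ ∀ i, |(x : b → ℤ) i| ≤ D := by
    intro z
    obtain ⟨y, rfl⟩ := Submodule.mkQ_surjective _ z
    obtain ⟨c, hc⟩ := hmul y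
    -- If `N • y = φ c`, subtracting `φ (c / N)` from `y` leaves `x` with `N • x = φ (c % N)`. The
    -- right side is at most `D * N` in each coordinate, so `x` is at most `D`.
    let c' : a → ℤ := fun j => c j / N
    let x : K := y - ⟨φ c', hle ⟨c', rfl⟩⟩
    refine ⟨x, ?_, fun i => ?_⟩
    · rw [map_sub, sub_eq_self, Submodule.mkQ_apply, Submodule.Quotient.mk_eq_zero,
        Submodule.submoduleOf, Submodule.mem_comap]
      exact ⟨c', rfl⟩
    · have hx : (N : ℤ) • (x : b → ℤ) = φ (fun j => c j % N) := by
        have : (fun j => c j % N) = c - (N : ℤ) • c' := by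
          funext j
          simp [c', Int.emod_def]
        rw [this, map_sub, map_smul, hc, ← smul_sub]
        rfl
      have h1 := hD (fun j => c j % N) N (fun j => by
        have h2 := Int.emod_nonneg (c j) (by positivity : (N : ℤ) ≠ 0)
        have h3 := Int.emod_lt_of_pos (c j) (by positivity : (0 : ℤ) < N)
        rw [abs_of_nonneg h2]; exact h3.le) i
      rw [← hx, Pi.smul_apply, smul_eq_mul, abs_mul, Nat.abs_cast, mul_comm] at h1
      exact le_of_mul_le_mul_right h1 (by positivity)
  choose r hr hrD using hrep
  let code : (K ⧸ (LinearMap.range φ).submoduleOf K) → (I → Finset.Icc (-(D : ℤ)) D) :=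
    fun z i => ⟨(r z : b → ℤ) i, Finset.mem_Icc.2 (abs_le.1 (hrD z i))⟩
  have hinj : Function.Injective code := by
    intro z z' h
    have h0 : ∀ i ∈ I, ((r z - r z' : K) : b → ℤ) i = 0 := by
      intro i hi
      have := congrArg Subtype.val (congrFun h ⟨i, hi⟩)
      simpa [code, sub_eq_zero] using this
    -- The separating coordinates apply only to the image of `φ`, which contains the difference
    -- after multiplication by `N`.
    obtain ⟨c, hc⟩ := hmul (r z - r z')
    have h1 : φ c = 0 := hsep c (fun i hi => by rw [hc, Pi.smul_apply, h0 i hi, smul_zero])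
    rw [hc] at h1
    have h2 : (r z - r z' : K) = 0 := by
      apply Subtype.ext
      exact (smul_eq_zero.1 h1).resolve_left (by positivity)
    rw [← hr z, ← hr z', sub_eq_zero.1 h2]
  calc N ≤ Nat.card (I → Finset.Icc (-(D : ℤ)) D) := Nat.card_le_card_of_injective code hinj
    _ = (2 * D + 1) ^ I.card := by
      simp only [Nat.card_eq_fintype_card, Fintype.card_fun, Fintype.card_coe, Int.card_Icc]
      congr 1
      omega
    _ ≤ _ := Nat.pow_le_pow_right (by omega) hI

namespace AbstractSimplicialComplex

theorem Face.card_le {n : ℕ} (X : AbstractSimplicialComplex (Fin n)) (k : ℕ) :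
    Nat.card (X.Face k) ≤ n ^ (k + 1) := by
  let f : X.Face k → Finset.powersetCard (k + 1) (Finset.univ : Finset (Fin n)) :=
    fun s => ⟨s.1, Finset.mem_powersetCard.2 ⟨Finset.subset_univ _, s.2.2⟩⟩
  have hf : Function.Injective f := fun s t h => Subtype.ext (congrArg (fun x => x.1) h)
  refine (Nat.card_le_card_of_injective f hf).trans ?_
  simpa using Nat.choose_le_pow n (k + 1)

theorem abs_coboundary_le {V : Type*} [LinearOrder V] (X : AbstractSimplicialComplex V) (k : ℕ)
    (c : X.Cochain k) (M : ℤ) (hc : ∀ s, |c s| ≤ M) (s : X.Face (k + 1)) :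
    |X.coboundary k c s| ≤ (k + 2 : ℕ) * M := by
  refine (Finset.abs_sum_le_sum_abs _ _).trans ?_
  refine (Finset.sum_le_card_nsmul _ _ M fun v _ => ?_).trans ?_
  · rw [abs_mul, Face.sign, abs_pow, abs_neg, abs_one, one_pow, one_mul]
    exact hc _
  · rw [Finset.card_attach, s.2.2, nsmul_eq_mul]

/-- The columns of the coboundary are the `k`-faces, at most `n ^ (k + 1)` many, and each row has `k
+ 2` entries `±1`. -/
theorem card_cohomology_le {n : ℕ} (X : AbstractSimplicialComplex (Fin n)) (k : ℕ)
    [Finite (X.Cohomology (k + 1))] :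
    Nat.card (X.Cohomology (k + 1)) ≤ (2 * (k + 2) + 1) ^ n ^ (k + 1) := by
  classical
  have h1 : ∀ j, Finite (X.Face j) := fun j => inferInstanceAs (Finite {s // _})
  have : ∀ j, Fintype (X.Face j) := fun j => Fintype.ofFinite _
  have : Finite (X.cocycles (k + 1) ⧸
      (LinearMap.range (X.coboundary k)).submoduleOf (X.cocycles (k + 1))) := ‹_›
  refine (card_quotient_range_le (X.coboundary k) (X.cocycles (k + 1))
    (X.coboundaries_le_cocycles (k + 1)) (k + 2)
    (X.abs_coboundary_le k)).trans ?_
  refine Nat.pow_le_pow_right (by omega) ?_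
  rw [← Nat.card_eq_fintype_card]
  exact Face.card_le X k

end AbstractSimplicialComplex

/-! ### Cone complexes and presentations of their top cohomology -/

/-- The family `w` exhibits `G` as the abelian group with generators `I` and the relations
`∑ i ∈ R j, w i = 0` for `j : J`. -/
structure IsPresentedBy {I J G : Type} [AddCommGroup G] (R : J → Finset I) (w : I → G) :
    Prop where
  relation : ∀ j, ∑ i ∈ R j, w i = 0
  generates : AddSubgroup.closure (Set.range w) = ⊤
  lift : ∀ (H : Type) [AddCommGroup H] (g : I → H), (∀ j, ∑ i ∈ R j, g i = 0) →
    ∃ θ : G →+ H, ∀ i, θ (w i) = g i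

namespace AbstractSimplicialComplex

variable {V : Type*} [LinearOrder V]

theorem coboundary_single_of_not_subset {k : ℕ} (X : AbstractSimplicialComplex V)
    [DecidableEq (X.Face k)]
    (e : X.Face k) (s : X.Face (k + 1)) (h : ¬ e.1 ⊆ s.1) :
    X.coboundary k (Pi.single e 1) s = 0 := by
  refine Finset.sum_eq_zero fun v _ => ?_
  have : s.delete v.1 v.2 ≠ e := by
    rintro rfl
    exact h (Finset.erase_subset _ _)
  simp [this]

theorem coboundary_single_of_delete {k : ℕ} (X : AbstractSimplicialComplex V)
    [DecidableEq (X.Face k)]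
    (e : X.Face k) (s : X.Face (k + 1)) (v : V) (hv : v ∈ s.1) (h : s.delete v hv = e) :
    X.coboundary k (Pi.single e 1) s = s.sign v := by
  refine (Finset.sum_eq_single ⟨v, hv⟩ ?_ ?_).trans ?_
  · rintro ⟨u, hu⟩ - hne
    have : s.delete u hu ≠ e := by
      intro h'
      have h1 : s.1.erase u = s.1.erase v := congrArg Subtype.val (h'.trans h.symm)
      have h2 : v ∈ s.1.erase u := Finset.mem_erase.2 ⟨fun h3 => hne (Subtype.ext h3.symm), hv⟩
      rw [h1] at h2
      simp at h2
    simp [this]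
  · simp
  · simp [h]

/-- The complex with all nonempty sets of at most `m` vertices as faces, the `m`-dimensional
faces `F`, and the cones with apex `ω` over the sets of `m` vertices outside `S`. -/
def coneComplex (ω : V) (F S : Set (Finset V)) (m : ℕ) (hm : 1 ≤ m) :
    AbstractSimplicialComplex V where
  faces := {s | s.Nonempty ∧
    (s.card ≤ m ∨ s.card = m + 1 ∧ (s ∈ F ∨ ω ∈ s ∧ s.erase ω ∉ S))}
  isRelLowerSet_faces := by
    rintro s ⟨hs, h⟩
    refine ⟨hs, fun t hts ht => ⟨ht, ?_⟩⟩
    rcases eq_or_ne t s with rfl | hne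
    · exact h
    · have := Finset.card_lt_card (lt_of_le_of_ne hts hne)
      left
      omega
  singleton_mem v := ⟨Finset.singleton_nonempty v, Or.inl (by simpa using hm)⟩

section Cone

variable {ω : V} {F S : Set (Finset V)} {m : ℕ} {hm : 1 ≤ m}

theorem coneComplex.isEmpty_face : IsEmpty ((coneComplex ω F S m hm).Face (m + 1)) :=
  ⟨fun s => by
    have h1 := s.2.2
    rcases s.2.1.2 with h | h <;> omega⟩

theorem coneComplex.cocycles_eq_top : (coneComplex ω F S m hm).cocycles m = ⊤ := by
  have := coneComplex.isEmpty_face (ω := ω) (F := F) (S := S) (m := m) (hm := hm)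
  rw [cocycles, LinearMap.ker_eq_top]
  exact LinearMap.ext fun f => Subsingleton.elim _ _

end Cone

/-- A homomorphism on cochains kills all coboundaries as soon as it kills the coboundaries of the
faces that miss the smallest vertex. -/
theorem range_coboundary_le_ker [Finite V] {ω : V} (hω : ∀ v, ω ≤ v)
    (X : AbstractSimplicialComplex V) {k : ℕ} {G : Type*} [AddCommGroup G]
    [∀ j, DecidableEq (X.Face j)] (Ψ : X.Cochain (k + 2) →ₗ[ℤ] G)
    (h : ∀ e : X.Face (k + 1), ω ∉ e.1 → Ψ (X.coboundary (k + 1) (Pi.single e 1)) = 0) :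
    LinearMap.range (X.coboundary (k + 1)) ≤ LinearMap.ker Ψ := by
  have h1 : ∀ j, Finite (X.Face j) := fun j => inferInstanceAs (Finite {s // _})
  have h2 : ∀ j, Fintype (X.Face j) := fun j => Fintype.ofFinite _
  let Φ := Ψ ∘ₗ X.coboundary (k + 1)
  have hΦ : ∀ f : X.Cochain (k + 1), Φ f = ∑ e, f e • Φ (Pi.single e 1) := by
    intro f
    conv_lhs => rw [← Finset.univ_sum_single f]
    rw [map_sum]
    refine Finset.sum_congr rfl fun e _ => ?_
    rw [← map_smul, ← Pi.single_smul, smul_eq_mul, mul_one]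
  have hall : ∀ e, Φ (Pi.single e 1) = 0 := by
    intro e
    by_cases he : ω ∈ e.1
    · have hc : (e.1.erase ω).card = k + 1 := by
        rw [Finset.card_erase_of_mem he, e.2.2]; rfl
      -- The identity `δ (δ f) = 0` expresses the image of `e` by those of faces missing `ω`: `e` is
      -- the only coface of `f` containing `ω`, and its sign is `1` because `ω` is smallest.
      let f : X.Face k := e.delete ω he
      have h3 : Φ (X.coboundary k (Pi.single f 1)) = 0 := by
        simp only [Φ, LinearMap.comp_apply, coboundary_coboundary, map_zero]
      rw [hΦ, Finset.sum_eq_single e] at h3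
      · rw [X.coboundary_single_of_delete f e ω he rfl] at h3
        have : e.sign ω = 1 := by
          rw [Face.sign, Finset.filter_false_of_mem (fun v _ => not_lt.2 (hω v))]
          rfl
        simpa [this] using h3
      · intro e' _ hne
        by_cases hs : f.1 ⊆ e'.1
        · have hω' : ω ∉ e'.1 := by
            intro hmem
            apply hne
            apply Subtype.ext
            have hsub : e.1 ⊆ e'.1 := by
              rw [← Finset.insert_erase he]
              exact Finset.insert_subset hmem hs
            exact (Finset.eq_of_subset_of_card_le hsub (by rw [e.2.2, e'.2.2])).symm
          rw [show Φ (Pi.single e' 1) = 0 from h e' hω', smul_zero]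
        · rw [X.coboundary_single_of_not_subset f e' hs, zero_smul]
      · simp
    · exact h e he
  rintro _ ⟨f, rfl⟩
  change Φ f = 0
  rw [hΦ]
  simp [hall]

end AbstractSimplicialComplex

namespace AbstractSimplicialComplex

/-- The family of top-dimensional faces missing the apex of a cone complex, together with the
sets of vertices that have no cone over them. The hypotheses say that a relation has constant
incidence sign. -/
structure ConeData (V : Type) [LinearOrder V] (k : ℕ) (I J : Type) where
  apex : V
  apex_le : ∀ v, apex ≤ v
  top : I → Finset V
  top_injective : Function.Injective top
  card_top : ∀ i, (top i).card = k + 3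
  apex_notMem_top : ∀ i, apex ∉ top i
  rel : J → Finset V
  card_rel : ∀ j, (rel j).card = k + 2
  apex_notMem_rel : ∀ j, apex ∉ rel j
  pos : J → ℕ
  card_filter : ∀ j i v, v ∉ rel j → insert v (rel j) = top i →
    ((top i).filter (fun u => u < v)).card = pos j

namespace ConeData

variable {V : Type} [LinearOrder V] {k : ℕ} {I J : Type} (D : ConeData V k I J)

/-- The cone complex of the given data. -/
def complex : AbstractSimplicialComplex V :=
  coneComplex D.apex (Set.range D.top) (Set.range D.rel) (k + 2) (by omega)

/-- The face of the cone complex with a given index. -/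
def face (i : I) : D.complex.Face (k + 2) :=
  ⟨D.top i, ⟨Finset.card_pos.1 (by rw [D.card_top]; omega),
    Or.inr ⟨D.card_top i, Or.inl ⟨i, rfl⟩⟩⟩, D.card_top i⟩

theorem face_injective : Function.Injective D.face :=
  fun _ _ h => D.top_injective (congrArg Subtype.val h)

theorem exists_face_eq (t : D.complex.Face (k + 2)) (ht : D.apex ∉ t.1) : ∃ i, D.face i = t := by
  have h1 := t.2.2
  rcases t.2.1.2 with h | ⟨-, ⟨i, hi⟩ | h⟩
  · omega
  · exact ⟨i, Subtype.ext hi⟩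
  · exact absurd h.1 ht

theorem apex_notMem_face (i : I) : D.apex ∉ (D.face i).1 := D.apex_notMem_top i

open Classical in
/-- The coboundary of the indicator of a face. -/
noncomputable def delta (e : D.complex.Face (k + 1)) : D.complex.Cochain (k + 2) :=
  D.complex.coboundary (k + 1) (Pi.single e 1)

theorem delta_of_delete_apex (e : D.complex.Face (k + 1)) (t : D.complex.Face (k + 2))
    (ht : D.apex ∈ t.1) (h : t.delete D.apex ht = e) : D.delta e t = 1 := by
  classical
  have := D.complex.coboundary_single_of_delete e t D.apex ht h
  rw [Face.sign, Finset.filter_false_of_mem (fun v _ => not_lt.2 (D.apex_le v)),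
    Finset.card_empty, pow_zero] at this
  rw [← this, delta]

theorem delta_eq_zero_of_apex_mem (e : D.complex.Face (k + 1)) (he : D.apex ∉ e.1)
    (t : D.complex.Face (k + 2)) (ht : D.apex ∈ t.1) (h : t.delete D.apex ht ≠ e) :
    D.delta e t = 0 := by
  classical
  rw [delta, coboundary_single_of_not_subset]
  intro hs
  apply h
  apply Subtype.ext
  have hsub : e.1 ⊆ t.1.erase D.apex := Finset.subset_erase.2 ⟨hs, he⟩
  refine (Finset.eq_of_subset_of_card_le hsub ?_).symm
  rw [Finset.card_erase_of_mem ht, t.2.2, e.2.2]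
  rfl

theorem exists_cone_or_rel (e : D.complex.Face (k + 1)) (he : D.apex ∉ e.1) :
    (∃ (t : D.complex.Face (k + 2)) (ht : D.apex ∈ t.1), t.delete D.apex ht = e) ∨
      ∃ j, D.rel j = e.1 := by
  by_cases h : e.1 ∈ Set.range D.rel
  · exact Or.inr h
  · left
    have hc : (insert D.apex e.1).card = k + 3 := by
      rw [Finset.card_insert_of_notMem he, e.2.2]
    refine ⟨⟨insert D.apex e.1, ⟨Finset.insert_nonempty _ _, Or.inr ⟨hc, Or.inr
      ⟨Finset.mem_insert_self _ _, ?_⟩⟩⟩, hc⟩, Finset.mem_insert_self _ _, ?_⟩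
    · rwa [Finset.erase_insert he]
    · exact Subtype.ext (Finset.erase_insert he)

section Sums

variable [Fintype I] [Fintype (D.complex.Face (k + 2))]

theorem sum_apex_notMem [DecidablePred fun t : D.complex.Face (k + 2) => D.apex ∈ t.1]
    {M : Type*} [AddCommGroup M] (g : D.complex.Face (k + 2) → M) :
    ∑ t with D.apex ∉ t.1, g t = ∑ i, g (D.face i) := by
  refine (Finset.sum_bij (fun i _ => D.face i) ?_ ?_ ?_ ?_).symm
  · intro i _
    simpa using D.apex_notMem_face i
  · intro i _ j _ h
    exact D.face_injective h
  · intro t ht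
    obtain ⟨i, hi⟩ := D.exists_face_eq t (Finset.mem_filter.1 ht).2
    exact ⟨i, Finset.mem_univ _, hi⟩
  · intros; rfl

/-- The cone over `e` is the only top face through the apex that contains `e`, so the relation of
`e` merely solves for the generator of this cone. -/
theorem sum_delta_of_cone {M : Type*} [AddCommGroup M] (e : D.complex.Face (k + 1))
    (t : D.complex.Face (k + 2)) (ht : D.apex ∈ t.1) (h : t.delete D.apex ht = e)
    (g : D.complex.Face (k + 2) → M) :
    ∑ s, D.delta e s • g s = g t + ∑ i, D.delta e (D.face i) • g (D.face i) := by
  classical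
  have he : D.apex ∉ e.1 := by
    rw [← h]
    exact Finset.notMem_erase _ _
  rw [← Finset.sum_filter_add_sum_filter_not Finset.univ (fun s => D.apex ∈ s.1),
    D.sum_apex_notMem (fun s => D.delta e s • g s), Finset.sum_eq_single t,
    D.delta_of_delete_apex e t ht h, one_smul]
  · intro s hs hne
    have hs' := (Finset.mem_filter.1 hs).2
    rw [D.delta_eq_zero_of_apex_mem e he s hs', zero_smul]
    intro h'
    apply hne
    apply Subtype.ext
    rw [← Finset.insert_erase hs', ← Finset.insert_erase ht]
    exact congrArg (insert D.apex) (congrArg Subtype.val (h'.trans h.symm))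
  · intro h'
    simp [ht] at h'

/-- Without a cone over `e`, only faces missing the apex occur, and `card_filter` gives them a
common sign. -/
theorem sum_delta_of_rel {M : Type*} [AddCommGroup M]
    (e : D.complex.Face (k + 1)) (j : J)
    (h : D.rel j = e.1) (g : D.complex.Face (k + 2) → M) :
    ∑ s, D.delta e s • g s =
      (-1 : ℤ) ^ D.pos j • ∑ i with D.rel j ⊆ D.top i, g (D.face i) := by
  classical
  have he : D.apex ∉ e.1 := h ▸ D.apex_notMem_rel j
  rw [← Finset.sum_filter_add_sum_filter_not Finset.univ (fun s => D.apex ∈ s.1),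
    D.sum_apex_notMem (fun s => D.delta e s • g s), Finset.sum_eq_zero, zero_add,
    Finset.sum_filter, Finset.smul_sum]
  · refine Finset.sum_congr rfl fun i _ => ?_
    by_cases hs : D.rel j ⊆ D.top i
    · rw [if_pos hs]
      congr 1
      obtain ⟨v, hv, hvi⟩ := Finset.exists_eq_insert_iff.2
        ⟨hs, by rw [D.card_top, D.card_rel]⟩
      have hmem : v ∈ (D.face i).1 := by
        change v ∈ D.top i
        rw [← hvi]
        exact Finset.mem_insert_self _ _
      have hdel : (D.face i).delete v hmem = e := by
        apply Subtype.ext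
        change (D.top i).erase v = e.1
        rw [← hvi, Finset.erase_insert hv, h]
      have := D.complex.coboundary_single_of_delete e (D.face i) v hmem hdel
      rw [delta, this, Face.sign, ← D.card_filter j i v hv hvi]
      rfl
    · rw [if_neg hs, smul_zero, delta, coboundary_single_of_not_subset, zero_smul]
      rw [← h]
      exact hs
  · intro s hs
    have hs' := (Finset.mem_filter.1 hs).2
    rw [D.delta_eq_zero_of_apex_mem e he s hs', zero_smul]
    intro h'
    have h1 := s.2.2
    rcases s.2.1.2 with h2 | ⟨-, ⟨i, hi⟩ | h2⟩
    · omega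
    · exact D.apex_notMem_top i (hi ▸ hs')
    · exact h2.2 ⟨j, h.trans (congrArg Subtype.val h').symm⟩

end Sums

open Classical in
/-- The top-dimensional cohomology of a cone complex is presented by the top-dimensional faces
missing the apex and the relations of the sets without a cone. -/
theorem nonempty_cohomology_equiv [Finite V] [Fintype I] {G : Type} [AddCommGroup G] {w : I → G}
    (hw : IsPresentedBy (fun j => Finset.univ.filter fun i => D.rel j ⊆ D.top i) w) :
    Nonempty (D.complex.Cohomology (k + 2) ≃+ G) := by
  set X := D.complex
  have : Finite (X.Face (k + 2)) := inferInstanceAs (Finite {s // _})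
  have : Fintype (X.Face (k + 2)) := Fintype.ofFinite _
  have htop : X.cocycles (k + 2) = ⊤ := coneComplex.cocycles_eq_top
  -- The value on a cone is forced by the relation of its base.
  let W : X.Face (k + 2) → G := fun t =>
    if ht : D.apex ∈ t.1 then
      -∑ i, D.delta (t.delete D.apex ht) (D.face i) • w i
    else w (D.exists_face_eq t ht).choose
  have hWface : ∀ i, W (D.face i) = w i := by
    intro i
    have hi := D.apex_notMem_face i
    simp only [W, dif_neg hi]
    exact congrArg w (D.face_injective (D.exists_face_eq (D.face i) hi).choose_spec)
  let Ψ : X.Cochain (k + 2) →ₗ[ℤ] G := Fintype.linearCombination ℤ W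
  have hΨ : ∀ f, Ψ f = ∑ t, f t • W t := fun f => rfl
  have hker : LinearMap.range (X.coboundary (k + 1)) ≤ LinearMap.ker Ψ := by
    refine X.range_coboundary_le_ker D.apex_le Ψ fun e he => ?_
    change Ψ (D.delta e) = 0
    rw [hΨ]
    rcases D.exists_cone_or_rel e he with ⟨t, ht, hte⟩ | ⟨j, hj⟩
    · rw [D.sum_delta_of_cone e t ht hte]
      simp only [W, dif_pos ht, hte]
      simp only [dif_neg (D.apex_notMem_face _)]
      rw [neg_add_eq_zero]
      refine Finset.sum_congr rfl fun i _ => ?_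
      rw [← hWface i]
      simp only [W, dif_neg (D.apex_notMem_face _)]
    · rw [D.sum_delta_of_rel e j hj]
      simp only [hWface]
      rw [hw.relation j, smul_zero]
  let Ψ' : X.Cohomology (k + 2) →ₗ[ℤ] G :=
    ((X.coboundaries (k + 2)).submoduleOf (X.cocycles (k + 2))).liftQ
      (Ψ ∘ₗ (X.cocycles (k + 2)).subtype) (fun x hx => hker hx)
  let cls : X.Cochain (k + 2) →ₗ[ℤ] X.Cohomology (k + 2) :=
    ((X.coboundaries (k + 2)).submoduleOf (X.cocycles (k + 2))).mkQ ∘ₗ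
      LinearMap.codRestrict (X.cocycles (k + 2)) LinearMap.id (fun f => htop ▸ Submodule.mem_top)
  have hcls : Function.Surjective cls := by
    intro z
    obtain ⟨y, rfl⟩ := Submodule.mkQ_surjective _ z
    exact ⟨y.1, rfl⟩
  have hcls0 : ∀ f, cls (X.coboundary (k + 1) f) = 0 := by
    intro f
    simp only [cls, LinearMap.comp_apply, Submodule.mkQ_apply, Submodule.Quotient.mk_eq_zero]
    exact ⟨f, rfl⟩
  have hΨcls : ∀ f, Ψ' (cls f) = Ψ f := fun f => rfl
  have hexp : ∀ f, cls f = ∑ t, f t • cls (Pi.single t 1) := by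
    intro f
    conv_lhs => rw [← Finset.univ_sum_single f]
    rw [map_sum]
    refine Finset.sum_congr rfl fun t _ => ?_
    rw [← map_smul, ← Pi.single_smul, smul_eq_mul, mul_one]
  have hdelta : ∀ e, ∑ t, D.delta e t • cls (Pi.single t 1) = 0 := by
    intro e
    rw [← hexp]
    exact hcls0 _
  obtain ⟨θ, hθ⟩ := hw.lift (X.Cohomology (k + 2)) (fun i => cls (Pi.single (D.face i) 1)) (by
    intro j
    have hj : (D.rel j).Nonempty := Finset.card_pos.1 (by rw [D.card_rel]; omega)
    let e : X.Face (k + 1) :=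
      ⟨D.rel j, ⟨hj, Or.inl (D.card_rel j).le⟩, D.card_rel j⟩
    have := hdelta e
    rw [D.sum_delta_of_rel e j rfl] at this
    exact ((isUnit_one.neg.pow _).smul_eq_zero).1 this)
  have hθΨ : ∀ z, θ (Ψ' z) = z := by
    intro z
    obtain ⟨f, rfl⟩ := hcls z
    rw [hΨcls, hΨ, hexp, map_sum]
    refine Finset.sum_congr rfl fun t _ => ?_
    rw [map_zsmul]
    congr 1
    by_cases ht : D.apex ∈ t.1
    · have h1 := hdelta (t.delete D.apex ht)
      rw [D.sum_delta_of_cone _ t ht rfl] at h1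
      simp only [W, dif_pos ht]
      rw [map_neg, map_sum, neg_eq_iff_add_eq_zero]
      refine (add_comm _ _).trans (Eq.trans ?_ h1)
      simp only [map_zsmul, hθ]
    · obtain ⟨i, rfl⟩ := D.exists_face_eq t ht
      rw [hWface, hθ]
  have hΨθ : ∀ x, Ψ' (θ x) = x := by
    intro x
    have hx : x ∈ AddSubgroup.closure (Set.range w) := hw.generates ▸ AddSubgroup.mem_top x
    induction hx using AddSubgroup.closure_induction with
    | mem y hy =>
      obtain ⟨i, rfl⟩ := hy
      rw [hθ, hΨcls, hΨ, Finset.sum_eq_single (D.face i)]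
      · simp [hWface]
      · intro t _ hne
        simp [hne]
      · simp
    | zero => simp
    | add y z _ _ hy hz => rw [map_add, map_add, hy, hz]
    | neg y _ hy => rw [map_neg, map_neg, hy]
  exact ⟨{ toFun := Ψ', invFun := θ, left_inv := hθΨ, right_inv := hΨθ, map_add' := map_add Ψ' }⟩

end ConeData

end AbstractSimplicialComplex

/-! ### Balanced complexes: faces as tuples of labels -/

/-- Vertices of balanced complexes: pairs of a position and a label, ordered by position first,
and an additional smallest vertex `0`. -/
def balancedVertex {m M : ℕ} (p : Fin m) (a : Fin M) : Fin (m * M + 1) :=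
  (finProdFinEquiv (p, a)).succ

theorem balancedVertex_lt {m M : ℕ} {p p' : Fin m} (h : p < p') (a a' : Fin M) :
    balancedVertex p a < balancedVertex p' a' := by
  rw [balancedVertex, balancedVertex, Fin.succ_lt_succ_iff, Fin.lt_def, finProdFinEquiv_apply_val,
    finProdFinEquiv_apply_val]
  have h1 : (p : ℕ) + 1 ≤ p' := h
  have h2 := Nat.mul_le_mul_left M h1
  have h3 := a.2
  simp only
  rw [Nat.mul_add] at h2
  omega

theorem balancedVertex_inj {m M : ℕ} {p p' : Fin m} {a a' : Fin M} :
    balancedVertex p a = balancedVertex p' a' ↔ p = p' ∧ a = a' := by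
  rw [balancedVertex, balancedVertex, Fin.succ_inj, EmbeddingLike.apply_eq_iff_eq, Prod.mk_inj]

theorem balancedVertex_ne_zero {m M : ℕ} (p : Fin m) (a : Fin M) : balancedVertex p a ≠ 0 :=
  Fin.succ_ne_zero _

/-- The set of vertices of a tuple of labels, restricted to some positions. -/
def balancedSet {m M : ℕ} (P : Finset (Fin m)) (τ : Fin m → Fin M) : Finset (Fin (m * M + 1)) :=
  P.image fun p => balancedVertex p (τ p)

section

variable {m M : ℕ} {P Q : Finset (Fin m)} {τ τ' : Fin m → Fin M}

theorem card_balancedSet : (balancedSet P τ).card = P.card :=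
  Finset.card_image_of_injective _ fun _ _ h => (balancedVertex_inj.1 h).1

theorem zero_notMem_balancedSet : (0 : Fin (m * M + 1)) ∉ balancedSet P τ := by
  simp [balancedSet, balancedVertex_ne_zero]

theorem balancedVertex_mem_balancedSet {p : Fin m} {a : Fin M} :
    balancedVertex p a ∈ balancedSet P τ ↔ p ∈ P ∧ τ p = a := by
  simp only [balancedSet, Finset.mem_image, balancedVertex_inj]
  constructor
  · rintro ⟨_, hp, rfl, h⟩
    exact ⟨hp, h⟩
  · rintro ⟨hp, h⟩
    exact ⟨p, hp, rfl, h⟩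

theorem balancedSet_subset_iff :
    balancedSet P τ ⊆ balancedSet Q τ' ↔ ∀ p ∈ P, p ∈ Q ∧ τ' p = τ p := by
  simp only [balancedSet, Finset.image_subset_iff]
  exact forall₂_congr fun p _ => balancedVertex_mem_balancedSet

theorem balancedSet_univ_injective :
    Function.Injective (balancedSet (m := m) (M := M) Finset.univ) := by
  intro τ τ' h
  funext p
  exact ((balancedSet_subset_iff.1 h.le p (Finset.mem_univ p)).2).symm

/-- Vertices are ordered by position first, so the vertex filling a hole at `h` has exactly `h`
predecessors, whatever the labels. This makes the incidence signs in a relation constant. -/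
theorem card_filter_lt_of_insert_eq {h : Fin m} {v : Fin (m * M + 1)}
    (hi : insert v (balancedSet (Finset.univ.erase h) τ) = balancedSet Finset.univ τ') :
    ((balancedSet Finset.univ τ').filter (fun u => u < v)).card = h := by
  have h1 : v = balancedVertex h (τ' h) := by
    have h2 : balancedVertex h (τ' h) ∈ insert v (balancedSet (Finset.univ.erase h) τ) := by
      rw [hi, balancedVertex_mem_balancedSet]
      exact ⟨Finset.mem_univ _, rfl⟩
    rcases Finset.mem_insert.1 h2 with h3 | h3
    · exact h3.symm
    · simp [balancedVertex_mem_balancedSet] at h3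
  have h2 : (balancedSet Finset.univ τ').filter (fun u => u < v) =
      balancedSet (Finset.Iio h) τ' := by
    ext u
    simp only [balancedSet, Finset.mem_filter, Finset.mem_image, Finset.mem_univ, true_and,
      Finset.mem_Iio]
    constructor
    · rintro ⟨⟨p, rfl⟩, hp⟩
      refine ⟨p, ?_, rfl⟩
      by_contra hcon
      rcases eq_or_lt_of_le (not_lt.1 hcon) with rfl | h4
      · exact hp.ne h1.symm
      · have := balancedVertex_lt h4 (τ' h) (τ' p)
        rw [← h1] at this
        exact lt_asymm hp this
    · rintro ⟨p, hp, rfl⟩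
      refine ⟨⟨p, rfl⟩, ?_⟩
      rw [h1]
      exact balancedVertex_lt hp _ _
  rw [h2, card_balancedSet, Fin.card_Iio]

end

/-- A group presented by tuples and tuples with a hole, a relation being the unsigned sum of the
tuples that fill the hole, is a cohomology group. -/
theorem exists_cohomology_equiv_of_tuples {k : ℕ} {I J G α : Type} [Fintype I] [Fintype α]
    [DecidableEq α] [AddCommGroup G] (tup : I → Fin (k + 3) → α) (htup : Function.Injective tup)
    (hole : J → Fin (k + 3)) (part : J → Fin (k + 3) → α) {w : I → G}
    (hw : IsPresentedBy
      (fun j => Finset.univ.filter fun i => ∀ p, p ≠ hole j → tup i p = part j p) w) :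
    ∃ X : AbstractSimplicialComplex (Fin ((k + 3) * Fintype.card α + 1)),
      Nonempty (X.Cohomology (k + 2) ≃+ G) := by
  let ψ := Fintype.equivFin α
  let D : AbstractSimplicialComplex.ConeData (Fin ((k + 3) * Fintype.card α + 1)) k I J :=
    { apex := 0
      apex_le := Fin.zero_le
      top := fun i => balancedSet Finset.univ (ψ ∘ tup i)
      top_injective := fun i i' h => htup (by
        have := balancedSet_univ_injective h
        funext p
        exact ψ.injective (congrFun this p))
      card_top := fun i => by simp [card_balancedSet]
      apex_notMem_top := fun i => zero_notMem_balancedSet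
      rel := fun j => balancedSet (Finset.univ.erase (hole j)) (ψ ∘ part j)
      card_rel := fun j => by
        rw [card_balancedSet, Finset.card_erase_of_mem (Finset.mem_univ _)]
        simp
      apex_notMem_rel := fun i => zero_notMem_balancedSet
      pos := fun j => hole j
      card_filter := fun j i v _ hi => card_filter_lt_of_insert_eq hi }
  refine ⟨D.complex, D.nonempty_cohomology_equiv (w := w) ?_⟩
  convert hw using 4 with j i
  simp [D, balancedSet_subset_iff]

/-! ### Networks: which tuples fill which holes -/

/-- A directed network with nodes `N` and arcs `A`, realized by tuples of labels: a node is a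
tuple with a single letter, and an arc changes the tuple of its source into that of its target one
position at a time, in the order given by `rank`, position `0` being the last. -/
structure LabelledNetwork (k : ℕ) (L Y N A Z K : Type) where
  letter : N → L
  coord : N → Fin (k + 3) → Y
  src : A → N
  tgt : A → N
  rank : A → Equiv.Perm (Fin (k + 3))
  inn : Z → N
  kill : K → N
  rank_zero : ∀ a, rank a 0 = Fin.last (k + 2)
  node_ext : ∀ h u v, letter u = letter v → (∀ p, p ≠ h → coord u p = coord v p) → u = v
  letter_ne : ∀ a, letter (src a) ≠ letter (tgt a)
  port_ext : ∀ a b, src a = src b → (rank a).symm 0 = (rank b).symm 0 → a = b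
  arc_ext : ∀ h a b, letter (src a) = letter (src b) → letter (tgt a) = letter (tgt b) →
    (∀ p, p ≠ h → coord (src a) p = coord (src b) p ∨ coord (tgt a) p = coord (tgt b) p) → a = b
  kill_port : ∀ c a, src a = kill c → (rank a).symm 0 ≠ 1

namespace LabelledNetwork

variable {k : ℕ} {L Y N A Z K : Type} (W : LabelledNetwork k L Y N A Z K)

/-- The tuple of a node. -/
def label (u : N) (p : Fin (k + 3)) : L × Y := (W.letter u, W.coord u p)

/-- The tuple obtained after `j` steps along an arc. -/
def step (a : A) (j : ℕ) (p : Fin (k + 3)) : L × Y :=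
  if (W.rank a p : ℕ) < j then W.label (W.tgt a) p else W.label (W.src a) p

/-- The tuples of a network. -/
def tup : N ⊕ A × Fin (k + 2) → Fin (k + 3) → L × Y
  | .inl u => W.label u
  | .inr (a, j) => W.step a (j + 1)

/-- The holes of the relations of a network. -/
def hole : Z ⊕ (A × Fin (k + 2)) ⊕ K → Fin (k + 3)
  | .inl _ => 0
  | .inr (.inl (a, j)) => (W.rank a).symm j.castSucc
  | .inr (.inr _) => 1

/-- The tuples of the relations of a network, to be disregarded at the hole. -/
def part : Z ⊕ (A × Fin (k + 2)) ⊕ K → Fin (k + 3) → L × Y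
  | .inl z => W.label (W.inn z)
  | .inr (.inl (a, j)) => W.step a j
  | .inr (.inr c) => W.label (W.kill c)

theorem label_fst (u : N) (p : Fin (k + 3)) : (W.label u p).1 = W.letter u := rfl

theorem step_of_lt {a : A} {j : ℕ} {p : Fin (k + 3)} (h : (W.rank a p : ℕ) < j) :
    W.step a j p = W.label (W.tgt a) p := if_pos h

theorem step_of_le {a : A} {j : ℕ} {p : Fin (k + 3)} (h : j ≤ W.rank a p) :
    W.step a j p = W.label (W.src a) p := if_neg (not_lt.2 h)

theorem step_zero_right (a : A) : W.step a 0 = W.label (W.src a) := by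
  funext p
  exact W.step_of_le (Nat.zero_le _)

theorem step_at_zero {a : A} {j : ℕ} (hj : j ≤ k + 2) :
    W.step a j 0 = W.label (W.src a) 0 := by
  apply W.step_of_le
  rw [W.rank_zero]
  simpa using hj

theorem label_ext {h : Fin (k + 3)} {u v : N} (H : ∀ p, p ≠ h → W.label u p = W.label v p) :
    u = v := by
  obtain ⟨p, hp⟩ := exists_ne h
  exact W.node_ext h u v (congrArg Prod.fst (H p hp)) fun p hp => congrArg Prod.snd (H p hp)

theorem symm_ne_zero (a : A) (j : Fin (k + 2)) : (W.rank a).symm j.castSucc ≠ 0 := by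
  intro h
  rw [Equiv.symm_apply_eq, W.rank_zero] at h
  exact (Fin.castSucc_lt_last j).ne h

theorem step_fst_of_lt {a : A} {j : ℕ} {p : Fin (k + 3)} (h : (W.rank a p : ℕ) < j) :
    (W.step a j p).1 = W.letter (W.tgt a) := by rw [W.step_of_lt h, label_fst]

theorem step_fst_of_le {a : A} {j : ℕ} {p : Fin (k + 3)} (h : j ≤ W.rank a p) :
    (W.step a j p).1 = W.letter (W.src a) := by rw [W.step_of_le h, label_fst]

/-- A step of an arc that agrees with a node, except possibly at one position different from `0`,
is the first step, along an arc that starts at that node and at that position. -/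
theorem step_eq_label {b : A} {l : ℕ} (hl : 1 ≤ l) (hl' : l ≤ k + 2) {u : N} {h : Fin (k + 3)}
    (hh : h ≠ 0) (H : ∀ p, p ≠ h → W.step b l p = W.label u p) :
    l = 1 ∧ W.src b = u ∧ (W.rank b).symm 0 = h := by
  have h0 := congrArg Prod.fst (H 0 hh.symm)
  rw [W.step_at_zero hl', label_fst, label_fst] at h0
  have hrank : ∀ p, p ≠ h → l ≤ W.rank b p := by
    intro p hp
    by_contra hcon
    have h1 := congrArg Prod.fst (H p hp)
    rw [W.step_fst_of_lt (not_le.1 hcon), label_fst, ← h0] at h1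
    exact W.letter_ne b h1.symm
  have hsrc : W.src b = u := W.label_ext (h := h) fun p hp => by
    rw [← H p hp, W.step_of_le (hrank p hp)]
  have hport : (W.rank b).symm 0 = h := by
    by_contra hcon
    have := hrank _ hcon
    simp at this
    omega
  refine ⟨?_, hsrc, hport⟩
  by_contra hne
  have h1 : (W.rank b).symm 1 ≠ h := by
    rw [← hport]
    simp
  have := hrank _ h1
  simp at this
  omega

theorem inn_label_iff (z : Z) (u : N) :
    (∀ p, p ≠ W.hole (.inl z) → W.tup (.inl u) p = W.part (.inl z) p) ↔ u = W.inn z :=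
  ⟨fun H => W.label_ext H, fun h p _ => by rw [h]; rfl⟩

/-- The first position changed is not `0`, so the node has the target letter, and every position
except `0` must already have been changed. As `0` comes last in the order, only the last tuple of an
incoming path qualifies. -/
theorem inn_step_iff (z : Z) (b : A) (l : Fin (k + 2)) :
    (∀ p, p ≠ W.hole (.inl z) → W.tup (.inr (b, l)) p = W.part (.inl z) p) ↔
      W.tgt b = W.inn z ∧ l = Fin.last (k + 1) := by
  simp only [hole, tup, part]
  constructor
  · intro H
    have hport : (W.rank b).symm 0 ≠ 0 := W.symm_ne_zero b 0
    have h1 := congrArg Prod.fst (H _ hport)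
    rw [W.step_fst_of_lt (by simp), label_fst] at h1
    have hrank : ∀ p, p ≠ 0 → (W.rank b p : ℕ) < l + 1 := by
      intro p hp
      by_contra hcon
      have h2 := congrArg Prod.fst (H p hp)
      rw [W.step_fst_of_le (not_lt.1 hcon), label_fst, ← h1] at h2
      exact W.letter_ne b h2
    refine ⟨W.label_ext (h := 0) fun p hp => by rw [← H p hp, W.step_of_lt (hrank p hp)], ?_⟩
    have h3 := hrank _ (W.symm_ne_zero b (Fin.last (k + 1)))
    apply Fin.ext
    simp at h3 ⊢
    omega
  · rintro ⟨h, rfl⟩ p hp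
    rw [← h, W.step_of_lt]
    have : W.rank b p ≠ Fin.last (k + 2) := by
      rw [← W.rank_zero b]
      exact fun h => hp ((W.rank b).injective h)
    have := Fin.val_lt_last this
    simp only [Fin.val_last]
    omega

theorem kill_label_iff (c : K) (u : N) :
    (∀ p, p ≠ W.hole (.inr (.inr c)) → W.tup (.inl u) p = W.part (.inr (.inr c)) p) ↔
      u = W.kill c :=
  ⟨fun H => W.label_ext H, fun h p _ => by rw [h]; rfl⟩

/-- By `step_eq_label`, only an arc leaving the node through position `1` could interfere, and
`kill_port` forbids it. -/
theorem not_kill_step (c : K) (b : A) (l : Fin (k + 2)) :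
    ¬ ∀ p, p ≠ W.hole (.inr (.inr c)) → W.tup (.inr (b, l)) p = W.part (.inr (.inr c)) p := by
  intro H
  obtain ⟨-, h1, h2⟩ := W.step_eq_label (by omega) (by omega) (Fin.succ_ne_zero 0) H
  exact W.kill_port c b h1 h2

theorem arc_label_iff (a : A) (j : Fin (k + 2)) (u : N) :
    (∀ p, p ≠ W.hole (.inr (.inl (a, j))) → W.tup (.inl u) p = W.part (.inr (.inl (a, j))) p) ↔
      u = W.src a ∧ j = 0 := by
  simp only [hole, tup, part]
  constructor
  · intro H
    by_cases hj : j = 0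
    · subst hj
      refine ⟨W.label_ext (h := (W.rank a).symm (Fin.castSucc 0)) fun p hp => ?_, rfl⟩
      rw [H p hp, Fin.val_zero, step_zero_right]
    · have hj' : 1 ≤ (j : ℕ) := Nat.one_le_iff_ne_zero.2 fun h => hj (Fin.ext h)
      obtain ⟨h1, h2, h3⟩ := W.step_eq_label hj' (by omega) (W.symm_ne_zero a j)
        (fun p hp => (H p hp).symm)
      rw [EmbeddingLike.apply_eq_iff_eq] at h3
      have := congrArg Fin.val h3
      simp at this
      omega
  · rintro ⟨rfl, rfl⟩ p _
    rw [Fin.val_zero, step_zero_right]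

/-- Position `0` still shows the source letter, and the first position changed by `a`, being
visible, shows the target letter. The letters elsewhere then tell which positions have been changed,
and `arc_ext` recovers the arc from the visible coordinates. -/
theorem eq_of_step_eq {a b : A} {j l : ℕ} (hj : 1 ≤ j) (hj' : j ≤ k + 2) (hl' : l ≤ k + 2)
    {h : Fin (k + 3)} (hh : h ≠ 0) (hp : (W.rank a).symm 0 ≠ h)
    (H : ∀ p, p ≠ h → W.step b l p = W.step a j p) :
    a = b ∧ ∀ p, p ≠ h → ((W.rank a p : ℕ) < l ↔ (W.rank a p : ℕ) < j) := by
  have h0 := congrArg Prod.fst (H 0 hh.symm)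
  rw [W.step_at_zero hj', W.step_at_zero hl', label_fst, label_fst] at h0
  have h1 := congrArg Prod.fst (H _ hp)
  rw [W.step_fst_of_lt (a := a) (by simp; omega)] at h1
  have htgt : W.letter (W.tgt b) = W.letter (W.tgt a) := by
    by_cases hlt : (W.rank b ((W.rank a).symm 0) : ℕ) < l
    · rwa [W.step_fst_of_lt hlt] at h1
    · rw [W.step_fst_of_le (not_lt.1 hlt), h0] at h1
      exact absurd h1 (W.letter_ne a)
  have key : ∀ p, p ≠ h → ((W.rank b p : ℕ) < l ↔ (W.rank a p : ℕ) < j) := by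
    intro p hp
    have h2 := congrArg Prod.fst (H p hp)
    by_cases hb : (W.rank b p : ℕ) < l <;> by_cases ha : (W.rank a p : ℕ) < j
    · simp [ha, hb]
    · rw [W.step_fst_of_lt hb, W.step_fst_of_le (not_lt.1 ha), htgt] at h2
      exact absurd h2.symm (W.letter_ne a)
    · rw [W.step_fst_of_lt ha, W.step_fst_of_le (not_lt.1 hb), h0] at h2
      exact absurd h2 (W.letter_ne a)
    · simp [ha, hb]
  have hab : a = b := by
    refine W.arc_ext h a b h0.symm htgt.symm fun p hp => ?_
    have h2 := congrArg Prod.snd (H p hp)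
    by_cases ha : (W.rank a p : ℕ) < j
    · rw [W.step_of_lt ha, W.step_of_lt ((key p hp).2 ha)] at h2
      exact Or.inr h2.symm
    · rw [W.step_of_le (not_lt.1 ha), W.step_of_le (not_lt.1 (mt (key p hp).1 ha))] at h2
      exact Or.inl h2.symm
  subst hab
  exact ⟨rfl, key⟩

/-- For `j = 0` the position changed first may be hidden, and `port_ext` identifies the arc; for `j
> 0` this is `eq_of_step_eq`. -/
theorem arc_step_iff (a : A) (j : Fin (k + 2)) (b : A) (l : Fin (k + 2)) :
    (∀ p, p ≠ W.hole (.inr (.inl (a, j))) →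
      W.tup (.inr (b, l)) p = W.part (.inr (.inl (a, j))) p) ↔
      b = a ∧ (l = j ∨ (l : ℕ) + 1 = j) := by
  simp only [hole, tup, part]
  constructor
  · intro H
    by_cases hj : j = 0
    · subst hj
      obtain ⟨h1, h2, h3⟩ := W.step_eq_label (l := l + 1) (u := W.src a) (by omega) (by omega)
        (W.symm_ne_zero a 0) (fun p hp => by rw [H p hp, Fin.val_zero, step_zero_right])
      exact ⟨W.port_ext b a h2 h3, Or.inl (Fin.ext (by simpa using h1))⟩
    · have hj' : 1 ≤ (j : ℕ) := Nat.one_le_iff_ne_zero.2 fun h => hj (Fin.ext h)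
      obtain ⟨rfl, h1⟩ := W.eq_of_step_eq hj' (by omega) (by omega) (W.symm_ne_zero a j)
        (by
          rw [ne_eq, EmbeddingLike.apply_eq_iff_eq]
          intro h
          have := congrArg Fin.val h
          simp at this
          omega) H
      refine ⟨rfl, ?_⟩
      have h2 : ∀ r : Fin (k + 3), (r : ℕ) ≠ j → ((r : ℕ) < l + 1 ↔ (r : ℕ) < j) := by
        intro r hr
        have := h1 ((W.rank a).symm r) (by
          rw [ne_eq, EmbeddingLike.apply_eq_iff_eq]
          intro h
          exact hr (congrArg Fin.val h))
        simpa using this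
      -- Only the position of rank `j` is hidden; its neighbours in the order force `j - 1 ≤ l ≤ j`.
      have h3 := h2 ⟨j - 1, by omega⟩ (by simp; omega)
      have h4 := h2 ⟨j + 1, by omega⟩ (by simp)
      simp only at h3 h4
      rw [Fin.ext_iff]
      omega
  · rintro ⟨rfl, h⟩ p hp
    have : (W.rank b p : ℕ) ≠ j := by
      intro h'
      apply hp
      rw [Equiv.eq_symm_apply]
      exact Fin.ext h'
    rcases lt_or_ge (W.rank b p : ℕ) j with h1 | h1
    · rw [W.step_of_lt h1, W.step_of_lt]
      rcases h with rfl | h <;> omega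
    · rw [W.step_of_le h1, W.step_of_le]
      rcases h with rfl | h <;> omega

theorem tup_injective : Function.Injective W.tup := by
  have hmixed : ∀ u a (j : Fin (k + 2)), W.label u ≠ W.step a (j + 1) := by
    intro u a j H
    -- Complete agreement permits the hole to be placed at `1` as well as at `2`, and the first
    -- position changed would have to be both. A third position exists because `d ≥ 2`.
    obtain ⟨-, -, h1⟩ := W.step_eq_label (b := a) (l := j + 1) (h := 1) (by omega) (by omega)
      (by simp) (fun p _ => (congrFun H p).symm)
    obtain ⟨-, -, h2⟩ := W.step_eq_label (b := a) (l := j + 1) (h := ⟨2, by omega⟩) (by omega) (by omega)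
      (by simp [Fin.ext_iff]) (fun p _ => (congrFun H p).symm)
    have := h1.symm.trans h2
    simp [Fin.ext_iff] at this
  rintro (u | ⟨a, j⟩) (v | ⟨b, l⟩) H
  · exact congrArg Sum.inl (W.label_ext (h := 0) fun p _ => congrFun H p)
  · exact absurd H (hmixed u b l)
  · exact absurd H.symm (hmixed v a j)
  · simp only [tup] at H
    obtain ⟨h, hh, hne⟩ : ∃ h : Fin (k + 3), h ≠ 0 ∧ (W.rank a).symm 0 ≠ h := by
      by_cases h1 : (W.rank a).symm 0 = 1
      · exact ⟨⟨2, by omega⟩, by simp [Fin.ext_iff], by rw [h1]; simp [Fin.ext_iff]⟩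
      · exact ⟨1, by simp, h1⟩
    obtain ⟨rfl, -⟩ := W.eq_of_step_eq (a := a) (b := b) (j := j + 1) (l := l + 1) (by omega)
      (by omega) (by omega) hh hne (fun p _ => (congrFun H p).symm)
    have h1 : ∀ x y : Fin (k + 2), x < y → W.step a (x + 1) ≠ W.step a (y + 1) := by
      intro x y hxy h2
      have h3 := congrArg Prod.fst (congrFun h2 ((W.rank a).symm y.castSucc))
      rw [W.step_fst_of_le, W.step_fst_of_lt] at h3
      · exact W.letter_ne a h3
      · simp
      · simpa using hxy
    rcases lt_trichotomy j l with h2 | rfl | h2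
    · exact absurd H (h1 _ _ h2)
    · rfl
    · exact absurd H.symm (h1 _ _ h2)

end LabelledNetwork

/-! ### From relations between nodes to relations between tuples -/

namespace LabelledNetwork

variable {k : ℕ} {L Y N A Z K : Type} (W : LabelledNetwork k L Y N A Z K)

open Classical in
/-- The tuples that fill the hole of a relation of a network. -/
noncomputable def fill [Fintype N] [Fintype A] (j : Z ⊕ (A × Fin (k + 2)) ⊕ K) :
    Finset (N ⊕ A × Fin (k + 2)) :=
  Finset.univ.filter fun i => ∀ p, p ≠ W.hole j → W.tup i p = W.part j p

open Classical in
/-- The arcs that end at a node. -/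
noncomputable def incoming [Fintype A] (u : N) : Finset A :=
  Finset.univ.filter fun a => W.tgt a = u

theorem mem_incoming [Fintype A] {u : N} {a : A} : a ∈ W.incoming u ↔ W.tgt a = u := by
  simp [incoming]

variable [Fintype N] [Fintype A] {H : Type} [AddCommGroup H] (g : N ⊕ A × Fin (k + 2) → H)

theorem sum_fill_inn (z : Z) :
    ∑ i ∈ W.fill (.inl z), g i =
      g (.inl (W.inn z)) + ∑ a ∈ W.incoming (W.inn z), g (.inr (a, Fin.last (k + 1))) := by
  classical
  rw [fill, Finset.sum_filter, Fintype.sum_sum_type]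
  simp only [inn_label_iff, inn_step_iff]
  congr 1
  · simp
  · rw [Fintype.sum_prod_type, incoming, Finset.sum_filter]
    refine Finset.sum_congr rfl fun a _ => ?_
    by_cases h : W.tgt a = W.inn z <;> simp [h]

theorem sum_fill_kill (c : K) :
    ∑ i ∈ W.fill (.inr (.inr c)), g i = g (.inl (W.kill c)) := by
  classical
  rw [fill, Finset.sum_filter, Fintype.sum_sum_type]
  simp only [kill_label_iff]
  rw [Finset.sum_eq_zero (s := (Finset.univ : Finset (A × Fin (k + 2))))]
  · simp
  · rintro ⟨a, j⟩ -
    rw [if_neg (W.not_kill_step c a j)]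

theorem sum_fill_arc_zero (a : A) :
    ∑ i ∈ W.fill (.inr (.inl (a, 0))), g i = g (.inl (W.src a)) + g (.inr (a, 0)) := by
  classical
  rw [fill, Finset.sum_filter, Fintype.sum_sum_type]
  simp only [arc_label_iff]
  congr 1
  · simp
  · rw [Finset.sum_eq_single (a, 0)]
    · rw [if_pos]
      rw [arc_step_iff]
      simp
    · rintro ⟨b, l⟩ - hne
      rw [if_neg]
      rw [arc_step_iff]
      simpa using hne
    · simp

theorem sum_fill_arc_succ (a : A) (j : Fin (k + 1)) :
    ∑ i ∈ W.fill (.inr (.inl (a, j.succ))), g i =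
      g (.inr (a, j.castSucc)) + g (.inr (a, j.succ)) := by
  classical
  have h : W.fill (.inr (.inl (a, j.succ))) =
      {Sum.inr (a, j.castSucc), Sum.inr (a, j.succ)} := by
    ext i
    rw [fill, Finset.mem_filter, Finset.mem_insert, Finset.mem_singleton]
    rcases i with u | ⟨b, l⟩
    · rw [arc_label_iff]
      simp
    · rw [arc_step_iff]
      simp only [Finset.mem_univ, true_and, Fin.val_succ, Sum.inr.injEq, Prod.mk.injEq,
        Fin.ext_iff, Fin.val_castSucc]
      constructor
      · rintro ⟨rfl, h⟩
        simp only [true_and]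
        omega
      · rintro (⟨rfl, h⟩ | ⟨rfl, h⟩) <;> simp only [true_and] <;> omega
  rw [h, Finset.sum_pair]
  simp [Fin.ext_iff]

/-- The relations between the nodes of a network. -/
structure NodeRelations (v : N → H) : Prop where
  inn : ∀ z, v (W.inn z) + (-1 : ℤ) ^ k • ∑ a ∈ W.incoming (W.inn z), v (W.src a) = 0
  kill : ∀ c, v (W.kill c) = 0

/-- Consecutive tuples of a path are opposite. The last of the `k + 2` tuples therefore carries
`(-1) ^ k` times the source, which is the sign in `NodeRelations`. -/
theorem eq_of_relations (hg : ∀ j, ∑ i ∈ W.fill j, g i = 0) (a : A) (j : Fin (k + 2)) :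
    g (.inr (a, j)) = (-1 : ℤ) ^ ((j : ℕ) + 1) • g (.inl (W.src a)) := by
  induction j using Fin.induction with
  | zero =>
    have := hg (.inr (.inl (a, 0)))
    rw [sum_fill_arc_zero] at this
    rw [eq_neg_of_add_eq_zero_right this]
    simp
  | succ j ih =>
    have := hg (.inr (.inl (a, j.succ)))
    rw [sum_fill_arc_succ] at this
    rw [eq_neg_of_add_eq_zero_right this, ih, Fin.val_castSucc, Fin.val_succ,
      pow_succ (-1 : ℤ) ((j : ℕ) + 1), mul_neg_one, neg_smul]

theorem nodeRelations_of_relations (hg : ∀ j, ∑ i ∈ W.fill j, g i = 0) :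
    W.NodeRelations fun u => g (.inl u) where
  inn z := by
    rw [← hg (.inl z), sum_fill_inn, Finset.smul_sum]
    congr 1
    refine Finset.sum_congr rfl fun a _ => ?_
    rw [W.eq_of_relations g hg, Fin.val_last]
    congr 1
    ring
  kill c := by
    rw [← hg (.inr (.inr c)), sum_fill_kill]

/-- A group presented by the nodes of a network is presented by its tuples. -/
theorem isPresentedBy {G : Type} [AddCommGroup G] {v : N → G} (hv : W.NodeRelations v)
    (hgen : AddSubgroup.closure (Set.range v) = ⊤)
    (hlift : ∀ (H : Type) [AddCommGroup H] (g : N → H), W.NodeRelations g →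
      ∃ θ : G →+ H, ∀ u, θ (v u) = g u) :
    IsPresentedBy W.fill
      (Sum.elim v fun x => (-1 : ℤ) ^ ((x.2 : ℕ) + 1) • v (W.src x.1)) where
  relation := by
    rintro (z | ⟨a, j⟩ | c)
    · rw [sum_fill_inn, ← hv.inn z, Finset.smul_sum]
      congr 1
      refine Finset.sum_congr rfl fun a _ => ?_
      rw [Sum.elim_inr, Fin.val_last]
      congr 1
      ring
    · cases j using Fin.cases with
      | zero =>
        rw [sum_fill_arc_zero]
        simp
      | succ j =>
        rw [sum_fill_arc_succ]
        simp [pow_succ]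
    · rw [sum_fill_kill]
      exact hv.kill c
  generates := by
    rw [eq_top_iff, ← hgen]
    refine AddSubgroup.closure_mono ?_
    rintro _ ⟨u, rfl⟩
    exact ⟨.inl u, rfl⟩
  lift H _ g hg := by
    obtain ⟨θ, hθ⟩ := hlift H (fun u => g (.inl u)) (W.nodeRelations_of_relations g hg)
    refine ⟨θ, ?_⟩
    rintro (u | ⟨a, j⟩)
    · exact hθ u
    · rw [W.eq_of_relations g hg, ← hθ (W.src a), ← map_zsmul]
      rfl

/-- A group presented by the nodes of a network is a cohomology group of a simplicial complex
with few vertices. -/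
theorem exists_cohomology_equiv [Fintype L] [Fintype Y] {G : Type} [AddCommGroup G] {v : N → G}
    (hv : W.NodeRelations v) (hgen : AddSubgroup.closure (Set.range v) = ⊤)
    (hlift : ∀ (H : Type) [AddCommGroup H] (g : N → H), W.NodeRelations g →
      ∃ θ : G →+ H, ∀ u, θ (v u) = g u) :
    ∃ X : AbstractSimplicialComplex
        (Fin ((k + 3) * (Fintype.card L * Fintype.card Y) + 1)),
      Nonempty (X.Cohomology (k + 2) ≃+ G) := by
  classical
  have h := exists_cohomology_equiv_of_tuples W.tup W.tup_injective W.hole W.part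
    (w := Sum.elim v fun x => (-1 : ℤ) ^ ((x.2 : ℕ) + 1) • v (W.src x.1)) (by
      convert W.isPresentedBy hv hgen hlift using 1
      funext j
      simp only [fill])
  rwa [Fintype.card_prod] at h

end LabelledNetwork

/-! ### A counter with a check digit -/

/-- The base `q` digits of `t`, preceded by minus their sum. -/
def counter (q d t : ℕ) : Fin (d + 1) → ZMod q :=
  Fin.cons (-∑ i : Fin d, ((t / q ^ (i : ℕ) : ℕ) : ZMod q)) fun i => ((t / q ^ (i : ℕ) : ℕ) : ZMod q)

/-- The digits that change from `t` to `t + 1`. -/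
def carries (q d t : ℕ) (i : Fin d) : Bool := decide (q ^ (i : ℕ) ∣ t + 1)

theorem sum_counter (q d t : ℕ) : ∑ p, counter q d t p = 0 := by
  simp [counter, Fin.sum_univ_succ]

/-- The coordinates sum to zero, so the hidden one is determined by the others. -/
theorem counter_injOn {q d t t' : ℕ} (ht : t < q ^ d) (ht' : t' < q ^ d) (h : Fin (d + 1))
    (H : ∀ p, p ≠ h → counter q d t p = counter q d t' p) : t = t' := by
  have hall : ∀ p, counter q d t p = counter q d t' p := by
    intro p
    by_cases hp : p = h
    · have h1 := (sum_counter q d t).trans (sum_counter q d t').symm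
      rw [← Finset.add_sum_erase _ _ (Finset.mem_univ h),
        ← Finset.add_sum_erase _ (counter q d t') (Finset.mem_univ h),
        Finset.sum_congr rfl (fun p hp => H p (Finset.ne_of_mem_erase hp))] at h1
      rw [hp]
      exact add_right_cancel h1
    · exact H p hp
  have hfun : finFunctionFinEquiv.symm (⟨t, ht⟩ : Fin (q ^ d)) =
      finFunctionFinEquiv.symm (⟨t', ht'⟩ : Fin (q ^ d)) := by
    funext i
    have h1 := hall i.succ
    simp only [counter, Fin.cons_succ] at h1
    exact Fin.ext ((ZMod.natCast_eq_natCast_iff' _ _ _).1 h1)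
  simpa using finFunctionFinEquiv.symm.injective hfun

theorem counter_succ (q d t : ℕ) (p : Fin (d + 1)) :
    counter q d (t + 1) p = counter q d t p +
      (Fin.cons (-∑ i, if carries q d t i then 1 else 0)
        (fun i => if carries q d t i then 1 else 0) : Fin (d + 1) → ZMod q) p := by
  have h : ∀ i : Fin d, (((t + 1) / q ^ (i : ℕ) : ℕ) : ZMod q) =
      ((t / q ^ (i : ℕ) : ℕ) : ZMod q) + if carries q d t i then 1 else 0 := by
    intro i
    rw [Nat.succ_div]
    push_cast
    simp [carries]
  cases p using Fin.cases with
  | zero =>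
    simp only [counter, Fin.cons_zero, h, Finset.sum_add_distrib, neg_add]
  | succ i =>
    simp only [counter, Fin.cons_succ, h]

/-- The increment from `t` to `t + 1` depends only on the carries. Knowing these, each coordinate
can be turned back separately, as is needed for tuples that mix two consecutive times. -/
theorem counter_eq_of_succ {q d t t' : ℕ} (hc : carries q d t = carries q d t')
    {p : Fin (d + 1)} (h : counter q d (t + 1) p = counter q d (t' + 1) p) :
    counter q d t p = counter q d t' p := by
  rw [counter_succ, counter_succ, hc] at h
  exact add_right_cancel h

/-- Consecutive disjoint intervals: all cyclic factors share one clock. -/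
theorem exists_offsets {ι : Type*} [Fintype ι] (n : ι → ℕ) :
    ∃ off : ι → ℕ, (∀ i l, l < n i → off i + l < ∑ i, n i) ∧
      ∀ i j l l', l < n i → l' < n j → off i + l = off j + l' → i = j ∧ l = l' := by
  let e := Fintype.equivFin ι
  let n' : Fin (Fintype.card ι) → ℕ := n ∘ e.symm
  let off : ι → ℕ := fun i => ∑ j : Fin (e i), n' (Fin.castLE (e i).is_le' j)
  have key : ∀ i l (h : l < n i), ∃ h' : l < n' (e i),
      (finSigmaFinEquiv (⟨e i, ⟨l, h'⟩⟩ : (i : Fin (Fintype.card ι)) × Fin (n' i)) : ℕ) =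
        off i + l := by
    intro i l h
    refine ⟨by simpa [n'] using h, ?_⟩
    rw [finSigmaFinEquiv_apply]
  refine ⟨off, ?_, ?_⟩
  · intro i l h
    obtain ⟨h', h1⟩ := key i l h
    rw [← h1, ← Equiv.sum_comp e.symm n]
    exact Fin.is_lt _
  · intro i j l l' h h' hij
    obtain ⟨h1, h2⟩ := key i l h
    obtain ⟨h3, h4⟩ := key j l' h'
    have h5 := finSigmaFinEquiv.injective (Fin.ext (h2.trans (hij.trans h4.symm)))
    have h6 : i = j := e.injective (congrArg Sigma.fst h5)
    subst h6
    refine ⟨rfl, ?_⟩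
    simpa using h5

/-! ### The doubling network -/

/-- The order in which an arc changes positions: first `p`, and last `0`. -/
def portRank {k : ℕ} (p : Fin (k + 3)) : Equiv.Perm (Fin (k + 3)) :=
  (Equiv.swap 1 p).trans (finRotate (k + 3)).symm

theorem portRank_zero {k : ℕ} {p : Fin (k + 3)} (hp : p ≠ 0) :
    portRank p 0 = Fin.last (k + 2) := by
  rw [portRank, Equiv.trans_apply, Equiv.swap_apply_of_ne_of_ne (by simp) hp.symm,
    Equiv.symm_apply_eq, finRotate_last]

theorem portRank_symm_zero {k : ℕ} (p : Fin (k + 3)) : (portRank p).symm 0 = p := by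
  rw [Equiv.symm_apply_eq, portRank, Equiv.trans_apply, Equiv.swap_apply_right, eq_comm,
    Equiv.symm_apply_eq, finRotate_apply, zero_add]

/-- Data for a network that presents `∏ i, ZMod (m i)`: the `i`-th factor is built in `len i`
doubling steps, at the times `off i, …, off i + len i`. -/
structure DoublingData (k q : ℕ) (ι : Type) where
  m : ι → ℕ
  len : ι → ℕ
  lt_two_pow : ∀ i, m i < 2 ^ len i
  off : ι → ℕ
  off_lt : ∀ i l, l < len i + 1 → off i + l < q ^ (k + 2)
  off_inj : ∀ i j l l', l < len i + 1 → l' < len j + 1 → off i + l = off j + l' → i = j ∧ l = l'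

namespace DoublingData

variable {k q : ℕ} {ι : Type} (D : DoublingData k q ι)

/-- The doubling steps. -/
abbrev Step : Type := Σ i, Fin (D.len i)

/-- The times between doubling steps. -/
abbrev Time : Type := Σ i, Fin (D.len i + 1)

/-- At every time there are three main nodes: `0` carries the value being doubled, `1` the
generator, and `2` is used to discard the generator. At every step there are four channels, the
first index indicating the source `0` or `1`, and the second one of two copies. -/
abbrev Node : Type := D.Time × Fin 3 ⊕ D.Step × (Bool × Bool)

/-- Every channel consists of two arcs. -/
abbrev Arc : Type := D.Step × (Bool × Bool) × Bool

/-- The time before a step. -/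
def before (s : D.Step) : D.Time := ⟨s.1, s.2.castSucc⟩

/-- The time after a step. -/
def after (s : D.Step) : D.Time := ⟨s.1, s.2.succ⟩

theorem before_injective : Function.Injective D.before := by
  rintro ⟨i, l⟩ ⟨j, l'⟩ h
  obtain rfl : i = j := congrArg Sigma.fst h
  simpa [before] using h

/-- The main node at the source of a channel. -/
def sourceKind (r : Bool × Bool) : Fin 3 := if r.1 then 1 else 0

/-- The binary digit that is processed in a step. -/
def digit (s : D.Step) : Bool := decide (D.m s.1 / 2 ^ (D.len s.1 - (s.2 + 1)) % 2 = 1)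

/-- The main node at the end of a channel. -/
def targetKind (s : D.Step) (r : Bool × Bool) : Fin 3 :=
  if r.1 then if r.2 then if D.digit s then 0 else 2 else 1 else 0

/-- The number of a time. -/
def number (t : D.Time) : ℕ := D.off t.1 + t.2

theorem number_lt (t : D.Time) : D.number t < q ^ (k + 2) := D.off_lt _ _ t.2.2

theorem number_injective : Function.Injective D.number := by
  rintro ⟨i, l⟩ ⟨j, l'⟩ h
  obtain ⟨rfl, h2⟩ := D.off_inj i j l l' l.2 l'.2 h
  rw [Fin.ext h2]

/-- The letters of the network. -/
abbrev Letter (k : ℕ) : Type := Fin 3 ⊕ (Bool × Bool) × (Fin (k + 2) → Bool)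

/-- The letter of a node. -/
def letter : D.Node → Letter k
  | .inl (_, x) => .inl x
  | .inr (s, r) => .inr (r, carries q (k + 2) (D.number (D.before s)))

/-- The time of a node. -/
def nodeTime : D.Node → D.Time
  | .inl (t, _) => t
  | .inr (s, _) => D.before s

/-- The source of an arc. -/
def src : D.Arc → D.Node
  | (s, r, false) => .inl (D.before s, sourceKind r)
  | (s, r, true) => .inr (s, r)

/-- The target of an arc. -/
def tgt : D.Arc → D.Node
  | (s, r, false) => .inr (s, r)
  | (s, r, true) => .inl (D.after s, D.targetKind s r)

/-- The position that an arc changes first. -/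
def port : D.Arc → Fin (k + 3)
  | (_, r, false) => if r.2 then ⟨2, by omega⟩ else 1
  | (_, _, true) => 1

theorem port_ne_zero (a : D.Arc) : D.port a ≠ 0 := by
  rcases a with ⟨s, ⟨r, r'⟩, b⟩
  cases b <;> cases r' <;> simp [port, Fin.ext_iff]

theorem counter_ext {t t' : D.Time} (h : Fin (k + 3))
    (H : ∀ p, p ≠ h → counter q (k + 2) (D.number t) p = counter q (k + 2) (D.number t') p) :
    t = t' :=
  D.number_injective (counter_injOn (D.number_lt t) (D.number_lt t') h H)

theorem node_ext (h : Fin (k + 3)) (u v : D.Node) (hl : D.letter u = D.letter v)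
    (H : ∀ p, p ≠ h → counter q (k + 2) (D.number (D.nodeTime u)) p =
      counter q (k + 2) (D.number (D.nodeTime v)) p) : u = v := by
  have ht := D.counter_ext h H
  rcases u with ⟨t, x⟩ | ⟨s, r⟩ <;> rcases v with ⟨t', x'⟩ | ⟨s', r'⟩ <;>
    simp only [letter, nodeTime, reduceCtorEq, Sum.inl.injEq, Sum.inr.injEq, Prod.mk.injEq]
      at hl ht ⊢
  · exact ⟨ht, hl⟩
  · exact ⟨D.before_injective ht, hl.1⟩

/-- The letters of both ends distinguish first from second arcs and give the channel. Both ends of a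
first arc have the same time. A second arc advances the time by one, and the carries stored in the
letter of its source translate coordinates at the target into coordinates at the source. -/
theorem arc_ext (h : Fin (k + 3)) (a b : D.Arc) (hs : D.letter (D.src a) = D.letter (D.src b))
    (ht : D.letter (D.tgt a) = D.letter (D.tgt b))
    (H : ∀ p, p ≠ h → counter q (k + 2) (D.number (D.nodeTime (D.src a))) p =
        counter q (k + 2) (D.number (D.nodeTime (D.src b))) p ∨
      counter q (k + 2) (D.number (D.nodeTime (D.tgt a))) p =
        counter q (k + 2) (D.number (D.nodeTime (D.tgt b))) p) : a = b := by
  rcases a with ⟨s, r, c⟩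
  rcases b with ⟨s', r', c'⟩
  cases c <;> cases c' <;>
    simp only [src, tgt, letter, nodeTime, reduceCtorEq, Sum.inl.injEq, Sum.inr.injEq,
      Prod.mk.injEq, or_self] at hs ht H ⊢
  · exact ⟨D.before_injective (D.counter_ext h H), ht.1, trivial⟩
  · refine ⟨D.before_injective (D.counter_ext h fun p hp => ?_), hs.1, trivial⟩
    rcases H p hp with h1 | h1
    · exact h1
    · exact counter_eq_of_succ hs.2 h1

/-- The network of the data. -/
def network : LabelledNetwork k (Letter k) (ZMod q) D.Node D.Arc
    {u : D.Node // ∀ i, u ≠ .inl (⟨i, 0⟩, 1)} ι where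
  letter := D.letter
  coord u := counter q (k + 2) (D.number (D.nodeTime u))
  src := D.src
  tgt := D.tgt
  rank a := portRank (D.port a)
  inn := Subtype.val
  kill i := .inl (⟨i, Fin.last _⟩, 0)
  rank_zero a := portRank_zero (D.port_ne_zero a)
  node_ext := D.node_ext
  letter_ne := by
    rintro ⟨s, r, c⟩
    cases c <;> simp [src, tgt, letter]
  -- At a main node, the kind of the source determines `r.1` and the port determines `r.2`: the two
  -- copies leave through positions `1` and `2`.
  port_ext := by
    rintro ⟨s, ⟨r1, r2⟩, c⟩ ⟨s', ⟨r1', r2'⟩, c'⟩ h hp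
    rw [portRank_symm_zero, portRank_symm_zero] at hp
    cases c <;> cases c' <;>
      simp only [src, reduceCtorEq, Sum.inl.injEq, Sum.inr.injEq, Prod.mk.injEq] at h ⊢
    · refine ⟨D.before_injective h.1, ⟨?_, ?_⟩, trivial⟩
      · have := h.2
        cases r1 <;> cases r1' <;> simp [sourceKind] at this ⊢
      · cases r2 <;> cases r2' <;> simp [port, Fin.ext_iff] at hp ⊢
    · exact ⟨h.1, h.2, trivial⟩
  arc_ext := D.arc_ext
  kill_port := by
    rintro i ⟨⟨j, l⟩, r, c⟩ h
    cases c <;> simp only [src, before, reduceCtorEq, Sum.inl.injEq, Prod.mk.injEq] at h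
    obtain ⟨h, -⟩ := h
    obtain rfl : j = i := congrArg Sigma.fst h
    simp only [Sigma.mk.injEq, heq_eq_eq, true_and] at h
    exact absurd h (Fin.castSucc_lt_last l).ne

theorem after_injective : Function.Injective D.after := by
  rintro ⟨i, l⟩ ⟨j, l'⟩ h
  obtain rfl : i = j := congrArg Sigma.fst h
  simpa [after] using h

/-- The second arcs of the channels of a step. -/
def secondArc (s : D.Step) : Bool × Bool ↪ D.Arc :=
  ⟨fun r => (s, r, true), fun r r' h => by simpa using h⟩

theorem secondArc_apply (s : D.Step) (r : Bool × Bool) : D.secondArc s r = (s, r, true) := rfl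

section Relations

variable [Fintype ι]

theorem incoming_channel (s : D.Step) (r : Bool × Bool) :
    D.network.incoming (.inr (s, r)) = {(s, r, false)} := by
  ext ⟨s', r', c⟩
  rw [LabelledNetwork.mem_incoming, Finset.mem_singleton]
  cases c <;> simp [network, tgt]

theorem incoming_zero (i : ι) (x : Fin 3) : D.network.incoming (.inl (⟨i, 0⟩, x)) = ∅ := by
  rw [Finset.eq_empty_iff_forall_notMem]
  rintro ⟨⟨j, l⟩, r, c⟩ h
  rw [LabelledNetwork.mem_incoming] at h
  cases c <;> simp only [network, tgt, after, reduceCtorEq, Sum.inl.injEq, Prod.mk.injEq] at h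
  obtain ⟨h, -⟩ := h
  obtain rfl : j = i := congrArg Sigma.fst h
  simp at h

theorem incoming_after (s : D.Step) (x : Fin 3) :
    D.network.incoming (.inl (D.after s, x)) =
      (Finset.univ.filter fun r => D.targetKind s r = x).map
        (D.secondArc s) := by
  ext ⟨s', r', c⟩
  rw [LabelledNetwork.mem_incoming]
  cases c
  · simp [network, tgt, secondArc_apply]
  · simp only [network, tgt, Finset.mem_filter, Finset.mem_univ, true_and, Sum.inl.injEq,
      Prod.mk.injEq, D.after_injective.eq_iff, Finset.mem_map, secondArc_apply,
      and_true]
    constructor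
    · rintro ⟨rfl, h⟩
      exact ⟨r', h, rfl, rfl⟩
    · rintro ⟨r, h, rfl, rfl⟩
      exact ⟨rfl, h⟩

theorem sum_incoming_after {H : Type} [AddCommGroup H] (f : D.Arc → H) (s : D.Step) (x : Fin 3) :
    ∑ a ∈ D.network.incoming (.inl (D.after s, x)), f a =
      ∑ r, if D.targetKind s r = x then f (s, r, true) else 0 := by
  rw [incoming_after, Finset.sum_map, Finset.sum_filter]
  rfl

/-- The relations of the network, made explicit. -/
structure Relations {H : Type} [AddCommGroup H] (g : D.Node → H) : Prop where
  channel : ∀ s r, g (.inr (s, r)) = -((-1 : ℤ) ^ k • g (.inl (D.before s, sourceKind r)))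
  start : ∀ i x, x ≠ 1 → g (.inl (⟨i, 0⟩, x)) = 0
  after : ∀ s x, g (.inl (D.after s, x)) =
    ∑ r, if D.targetKind s r = x then g (.inl (D.before s, sourceKind r)) else 0
  kill : ∀ i, g (.inl (⟨i, Fin.last _⟩, 0)) = 0

/-- Each arc multiplies by `-(-1) ^ k`. A channel has two arcs, so it transports the value of its
source unchanged. -/
theorem nodeRelations_iff {H : Type} [AddCommGroup H] (g : D.Node → H) :
    D.network.NodeRelations g ↔ D.Relations g := by
  have hsq : ∀ x : H, (-1 : ℤ) ^ k • (-((-1 : ℤ) ^ k • x)) = -x := by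
    intro x
    rw [smul_neg, smul_smul, ← pow_add, Even.neg_one_pow ⟨k, rfl⟩, one_smul]
  constructor
  · intro h
    have hch : ∀ s r, g (.inr (s, r)) =
        -((-1 : ℤ) ^ k • g (.inl (D.before s, sourceKind r))) := by
      intro s r
      have := h.inn ⟨.inr (s, r), fun i => Sum.inr_ne_inl⟩
      change g (.inr (s, r)) + (-1 : ℤ) ^ k •
        ∑ a ∈ D.network.incoming (.inr (s, r)), g (D.src a) = 0 at this
      rw [incoming_channel, Finset.sum_singleton] at this
      exact eq_neg_of_add_eq_zero_left this
    refine ⟨hch, fun i x hx => ?_, fun s x => ?_, h.kill⟩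
    · have := h.inn ⟨.inl (⟨i, 0⟩, x), fun j h => hx (congrArg Prod.snd (Sum.inl_injective h))⟩
      change g (.inl (⟨i, 0⟩, x)) + (-1 : ℤ) ^ k •
        ∑ a ∈ D.network.incoming (.inl (⟨i, 0⟩, x)), g (D.src a) = 0 at this
      rwa [incoming_zero, Finset.sum_empty, smul_zero, add_zero] at this
    · have := h.inn ⟨.inl (D.after s, x), fun j h => by
        have h := congrArg Prod.fst (Sum.inl_injective h)
        obtain ⟨i, l⟩ := s
        obtain rfl : i = j := congrArg Sigma.fst h
        simp [DoublingData.after] at h⟩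
      change g (.inl (D.after s, x)) + (-1 : ℤ) ^ k •
        ∑ a ∈ D.network.incoming (.inl (D.after s, x)), g (D.src a) = 0 at this
      rw [D.sum_incoming_after, Finset.smul_sum] at this
      rw [eq_neg_of_add_eq_zero_left this, ← Finset.sum_neg_distrib]
      refine Finset.sum_congr rfl fun r _ => ?_
      by_cases hr : D.targetKind s r = x
      · rw [if_pos hr, if_pos hr, src, hch, hsq, neg_neg]
      · rw [if_neg hr, if_neg hr, smul_zero, neg_zero]
  · intro h
    refine ⟨?_, h.kill⟩
    rintro ⟨⟨⟨i, l⟩, x⟩ | ⟨s, r⟩, hu⟩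
    · cases l using Fin.cases with
      | zero =>
        change g (.inl (⟨i, 0⟩, x)) + (-1 : ℤ) ^ k •
          ∑ a ∈ D.network.incoming (.inl (⟨i, 0⟩, x)), g (D.src a) = 0
        rw [incoming_zero, Finset.sum_empty, smul_zero, add_zero]
        exact h.start i x fun hx => hu i (by rw [hx])
      | succ l =>
        change g (.inl (D.after ⟨i, l⟩, x)) + (-1 : ℤ) ^ k •
          ∑ a ∈ D.network.incoming (.inl (D.after ⟨i, l⟩, x)), g (D.src a) = 0
        rw [D.sum_incoming_after, Finset.smul_sum, h.after, ← Finset.sum_add_distrib]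
        refine Finset.sum_eq_zero fun r _ => ?_
        by_cases hr : D.targetKind ⟨i, l⟩ r = x
        · rw [if_pos hr, if_pos hr, src, h.channel, hsq, add_neg_cancel]
        · rw [if_neg hr, if_neg hr, smul_zero, add_zero]
    · change g (.inr (s, r)) + (-1 : ℤ) ^ k •
        ∑ a ∈ D.network.incoming (.inr (s, r)), g (D.src a) = 0
      rw [incoming_channel, Finset.sum_singleton, h.channel]
      exact neg_add_cancel _

end Relations

end DoublingData

/-! ### Solving the relations of the doubling network -/

namespace DoublingData

variable {k q : ℕ} {ι : Type} (D : DoublingData k q ι)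

/-- The leading binary digits of `m i` that have been processed at a given time. -/
def leading (t : D.Time) : ℕ := D.m t.1 / 2 ^ (D.len t.1 - t.2)

theorem leading_zero (i : ι) : D.leading ⟨i, 0⟩ = 0 :=
  Nat.div_eq_of_lt (by simpa using D.lt_two_pow i)

theorem leading_last (i : ι) : D.leading ⟨i, Fin.last _⟩ = D.m i := by
  simp [leading]

/-- Horner's rule, with the binary digits read from the top. -/
theorem leading_after (s : D.Step) :
    D.leading (D.after s) = 2 * D.leading (D.before s) + if D.digit s then 1 else 0 := by
  obtain ⟨i, l⟩ := s
  have h : D.len i - l = D.len i - (l + 1) + 1 := by omega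
  simp only [leading, after, before, digit, Fin.val_succ, Fin.val_castSucc]
  rw [h, pow_succ, ← Nat.div_div_eq_div_mul]
  have key : ∀ x : ℕ, x = 2 * (x / 2) + if decide (x % 2 = 1) then 1 else 0 := by
    intro x
    rcases Nat.mod_two_eq_zero_or_one x with h | h <;> simp [h] <;> omega
  exact key _

section

variable {H : Type} [AddCommGroup H]

/-- The values of a solution of the relations at the main nodes. -/
def mainSolution (y : ι → H) : D.Time × Fin 3 → H
  | (t, 0) => D.leading t • y t.1
  | (t, 1) => y t.1
  | (⟨i, l⟩, 2) => Fin.cases 0 (fun l => if D.digit ⟨i, l⟩ then 0 else y i) l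

/-- The solution of the relations with given values at the generators. -/
def solution (y : ι → H) : D.Node → H
  | .inl x => D.mainSolution y x
  | .inr (s, r) => -((-1 : ℤ) ^ k • D.mainSolution y (D.before s, sourceKind r))

/-- Both copies of the running value arrive here, which doubles it; the spare copy of the generator
joins them exactly when the digit is `1`. -/
theorem sum_targetKind_zero (s : D.Step) (f : Fin 3 → H) :
    (∑ r, if D.targetKind s r = 0 then f (sourceKind r) else 0) =
      2 • f 0 + if D.digit s then f 1 else 0 := by
  cases h : D.digit s <;> simp [Fintype.sum_prod_type, targetKind, sourceKind, h] <;> abel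

theorem sum_targetKind_one (s : D.Step) (f : Fin 3 → H) :
    (∑ r, if D.targetKind s r = 1 then f (sourceKind r) else 0) = f 1 := by
  cases h : D.digit s <;> simp [Fintype.sum_prod_type, targetKind, sourceKind, h]

theorem sum_targetKind_two (s : D.Step) (f : Fin 3 → H) :
    (∑ r, if D.targetKind s r = 2 then f (sourceKind r) else 0) =
      if D.digit s then 0 else f 1 := by
  cases h : D.digit s <;> simp [Fintype.sum_prod_type, targetKind, sourceKind, h]

theorem relations_solution (y : ι → H) (hy : ∀ i, D.m i • y i = 0) :
    D.Relations (D.solution y) where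
  channel s r := rfl
  start i x hx := by
    fin_cases x
    · change D.leading ⟨i, 0⟩ • y i = 0
      rw [leading_zero, zero_smul]
    · exact absurd rfl hx
    · rfl
  after s x := by
    fin_cases x
    · refine Eq.trans ?_ (D.sum_targetKind_zero s fun x => D.solution y (.inl (D.before s, x))).symm
      change D.leading (D.after s) • y s.1 = 2 • D.leading (D.before s) • y s.1 +
        if D.digit s then y s.1 else 0
      rw [leading_after, add_smul, mul_smul]
      cases D.digit s <;> simp
    · exact (D.sum_targetKind_one s fun x => D.solution y (.inl (D.before s, x))).symm
    · exact (D.sum_targetKind_two s fun x => D.solution y (.inl (D.before s, x))).symm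
  kill i := by
    change D.leading ⟨i, Fin.last _⟩ • y i = 0
    rw [leading_last, hy]

variable {D} in
-- Every node other than the generators at time `0` is either zero or a sum of nodes at the
-- preceding time, up to the sign of a channel; induction on time leaves only the generators free.
-- The relation `kill` then becomes `m i • y i = 0`.
theorem Relations.eq_solution {g : D.Node → H} (hg : D.Relations g) :
    g = D.solution fun i => g (.inl (⟨i, 0⟩, 1)) := by
  have hmain : ∀ i (l : Fin (D.len i + 1)) x, g (.inl (⟨i, l⟩, x)) =
      D.mainSolution (fun i => g (.inl (⟨i, 0⟩, 1))) (⟨i, l⟩, x) := by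
    intro i l
    induction l using Fin.induction with
    | zero =>
      intro x
      fin_cases x
      · refine (hg.start i 0 (by decide)).trans ?_
        change 0 = D.leading ⟨i, 0⟩ • g (.inl (⟨i, 0⟩, 1))
        rw [leading_zero, zero_smul]
      · rfl
      · exact hg.start i 2 (by decide)
    | succ l ih =>
      intro x
      have h := hg.after ⟨i, l⟩
      have h0 : g (.inl (D.before ⟨i, l⟩, 0)) =
        D.leading (D.before ⟨i, l⟩) • g (.inl (⟨i, 0⟩, 1)) := ih 0
      have h1 : g (.inl (D.before ⟨i, l⟩, 1)) = g (.inl (⟨i, 0⟩, 1)) := ih 1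
      fin_cases x
      · refine (h 0).trans ?_
        rw [D.sum_targetKind_zero ⟨i, l⟩ fun x => g (.inl (D.before ⟨i, l⟩, x)), h0, h1]
        change _ = D.leading (D.after ⟨i, l⟩) • g (.inl (⟨i, 0⟩, 1))
        rw [leading_after, add_smul, mul_smul]
        cases D.digit ⟨i, l⟩ <;> simp
      · refine (h 1).trans ?_
        rw [D.sum_targetKind_one ⟨i, l⟩ fun x => g (.inl (D.before ⟨i, l⟩, x)), h1]
        rfl
      · refine (h 2).trans ?_
        rw [D.sum_targetKind_two ⟨i, l⟩ fun x => g (.inl (D.before ⟨i, l⟩, x)), h1]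
        rfl
  funext u
  rcases u with ⟨⟨i, l⟩, x⟩ | ⟨s, r⟩
  · exact hmain i l x
  · rw [hg.channel]
    exact congrArg (fun z => -((-1 : ℤ) ^ k • z)) (hmain _ _ _)

variable {D} in
theorem Relations.smul_eq_zero {g : D.Node → H} (hg : D.Relations g) (i : ι) :
    D.m i • g (.inl (⟨i, 0⟩, 1)) = 0 := by
  rw [← hg.kill i, hg.eq_solution]
  change _ = D.leading ⟨i, Fin.last _⟩ • g (.inl (⟨i, 0⟩, 1))
  rw [leading_last]
  rfl

theorem map_solution {G : Type} [AddCommGroup G] (θ : G →+ H) (y : ι → G) (u : D.Node) :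
    θ (D.solution y u) = D.solution (fun i => θ (y i)) u := by
  have hmain : ∀ x, θ (D.mainSolution y x) = D.mainSolution (fun i => θ (y i)) x := by
    rintro ⟨⟨i, l⟩, x⟩
    fin_cases x
    · exact map_nsmul θ _ _
    · rfl
    · cases l using Fin.cases with
      | zero => exact map_zero θ
      | succ l =>
        change θ (if D.digit ⟨i, l⟩ then 0 else y i) = if D.digit ⟨i, l⟩ then 0 else θ (y i)
        cases D.digit ⟨i, l⟩ <;> simp
  rcases u with x | ⟨s, r⟩
  · exact hmain x
  · simp only [solution, map_neg, map_zsmul, hmain]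

end

/-- The product of cyclic groups of the data is a cohomology group of a simplicial complex with
few vertices. -/
theorem exists_cohomology_equiv [Fintype ι] [NeZero q] :
    ∃ X : AbstractSimplicialComplex (Fin ((k + 3) * (Fintype.card (Letter k) * q) + 1)),
      Nonempty (X.Cohomology (k + 2) ≃+ ∀ i, ZMod (D.m i)) := by
  classical
  let y : ι → ∀ i, ZMod (D.m i) := fun i => Pi.single i 1
  have hy : ∀ i, D.m i • y i = 0 := by
    intro i
    simp only [y]
    rw [← Pi.single_smul, nsmul_one, ZMod.natCast_self, Pi.single_zero]
  have h := D.network.exists_cohomology_equiv (v := D.solution y)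
    ((D.nodeRelations_iff _).2 (D.relations_solution y hy)) (by
      rw [eq_top_iff]
      intro x _
      rw [← Finset.univ_sum_single x]
      refine sum_mem fun i _ => ?_
      obtain ⟨z, hz⟩ := ZMod.intCast_surjective (x i)
      have : Pi.single i (x i) = z • y i := by
        simp only [y]
        rw [← Pi.single_smul, zsmul_one, hz]
      rw [this]
      have hmem : y i ∈ Set.range (D.solution y) := ⟨.inl (⟨i, 0⟩, 1), rfl⟩
      exact AddSubgroup.zsmul_mem _ (AddSubgroup.subset_closure hmem) z)
    (fun H _ g hg => by
      have hg := (D.nodeRelations_iff g).1 hg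
      let φ : ∀ i, ZMod (D.m i) →+ H := fun i =>
        ZMod.lift (D.m i) ⟨zmultiplesHom H (g (.inl (⟨i, 0⟩, 1))), by
          simpa using hg.smul_eq_zero i⟩
      let θ : (∀ i, ZMod (D.m i)) →+ H := ∑ i, (φ i).comp (Pi.evalAddMonoidHom _ i)
      have hθ : ∀ i, θ (y i) = g (.inl (⟨i, 0⟩, 1)) := by
        intro i
        simp only [θ, y, AddMonoidHom.finsetSum_apply, AddMonoidHom.comp_apply,
          Pi.evalAddMonoidHom_apply]
        rw [Finset.sum_eq_single i]
        · simp only [φ]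
          rw [Pi.single_eq_same, ← Int.cast_one, ZMod.lift_coe]
          simp
        · intro j _ hj
          rw [Pi.single_eq_of_ne hj, map_zero]
        · simp
      refine ⟨θ, fun u => ?_⟩
      rw [map_solution]
      simp only [hθ]
      exact (congrFun hg.eq_solution u).symm)
  rwa [ZMod.card] at h

end DoublingData

/-! ### The two bounds -/

/-- A finite product of cyclic groups is a cohomology group of a complex whose number of vertices
is governed by the number of binary digits of the orders. -/
theorem exists_cohomology_equiv_pi_zmod (k q : ℕ) [NeZero q] {ι : Type} [Fintype ι] (m : ι → ℕ)
    (hq : ∑ i, (Nat.log 2 (m i) + 2) ≤ q ^ (k + 2)) :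
    ∃ X : AbstractSimplicialComplex
        (Fin ((k + 3) * (Fintype.card (DoublingData.Letter k) * q) + 1)),
      Nonempty (X.Cohomology (k + 2) ≃+ ∀ i, ZMod (m i)) := by
  obtain ⟨off, h1, h2⟩ := exists_offsets fun i => Nat.log 2 (m i) + 2
  let D : DoublingData k q ι :=
    { m := m
      -- There are `Nat.log 2 (m i) + 1` binary digits to process, hence one more time than that,
      -- which explains the summand `2` in `hq`.
      len := fun i => Nat.log 2 (m i) + 1
      lt_two_pow := fun i => Nat.lt_pow_succ_log_self one_lt_two _
      off := off
      off_lt := fun i l hl => (h1 i l hl).trans_le hq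
      off_inj := h2 }
  exact D.exists_cohomology_equiv

theorem natCast_log_mul_log_le {m : ℕ} (hm : m ≠ 0) :
    (Nat.log 2 m : ℝ) * Real.log 2 ≤ Real.log m := by
  rw [← Real.log_pow]
  refine Real.log_le_log (by positivity) ?_
  exact_mod_cast Nat.pow_log_le_self 2 hm

theorem log_card_le_of_mem_cohomologyVertexCounts {k n : ℕ} {G : Type*} [AddCommGroup G]
    [Finite G] (hn : n ∈ cohomologyVertexCounts (k + 2) G) :
    Real.log (Nat.card G) ≤ Real.log (2 * (k + 3) + 1) * (n : ℝ) ^ (k + 2) := by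
  obtain ⟨X, ⟨e⟩⟩ := hn
  have : Finite (X.Cohomology (k + 1 + 1)) := Finite.of_equiv G e.symm.toEquiv
  have h := X.card_cohomology_le (k + 1)
  rw [Nat.card_congr e.toEquiv] at h
  have h1 : ((Nat.card G : ℕ) : ℝ) ≤ (2 * (k + 3) + 1) ^ n ^ (k + 2) := by
    have h2 : ((Nat.card G : ℕ) : ℝ) ≤ (((2 * (k + 1 + 2) + 1) ^ n ^ (k + 1 + 1) : ℕ) : ℝ) := by
      exact_mod_cast h
    refine h2.trans (le_of_eq ?_)
    push_cast
    ring_nf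
  have h3 := Real.log_le_log (by exact_mod_cast Nat.card_pos) h1
  rw [Real.log_pow] at h3
  push_cast at h3
  linarith

/-- For the trivial group the upper bound is `0`, so only the empty complex will do. -/
theorem zero_mem_cohomologyVertexCounts {k : ℕ} {G : Type*} [AddCommGroup G] [Subsingleton G] :
    0 ∈ cohomologyVertexCounts (k + 2) G := by
  let X : AbstractSimplicialComplex (Fin 0) := ⊤
  have : IsEmpty (X.Face (k + 2)) := ⟨fun s => by
    have h := s.2.2
    rw [Finset.eq_empty_of_isEmpty s.1] at h
    simp at h⟩
  have : Subsingleton (X.Cochain (k + 2)) := inferInstanceAs (Subsingleton (_ → ℤ))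
  have : Subsingleton (X.Cohomology (k + 2)) :=
    (Submodule.mkQ_surjective _).subsingleton
  refine ⟨X, ⟨{ toFun := 0, invFun := 0, left_inv := ?_, right_inv := ?_, map_add' := ?_ }⟩⟩
  · intro x
    exact Subsingleton.elim _ _
  · intro x
    exact Subsingleton.elim _ _
  · intro x y
    exact Subsingleton.elim _ _

theorem exists_mem_cohomologyVertexCounts_le (k : ℕ) (G : Type*) [AddCommGroup G] [Finite G]
    [Nontrivial G] : ∃ n ∈ cohomologyVertexCounts (k + 2) G,
      (n : ℝ) ≤ ((k + 3) * Fintype.card (DoublingData.Letter k) + 1) *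
        (2 * (3 / Real.log 2) ^ (1 / ((k + 2 : ℕ) : ℝ))) *
        Real.log (Nat.card G) ^ (1 / ((k + 2 : ℕ) : ℝ)) := by
  obtain ⟨ι, _, m, hm, ⟨e⟩⟩ := AddCommGroup.equiv_directSum_zmod_of_finite' G
  classical
  have hlog2 : 0 < Real.log 2 := Real.log_pos one_lt_two
  have e' : (∀ i, ZMod (m i)) ≃+ G := (e.trans (DirectSum.addEquivProd _)).symm
  have hcard : Real.log (Nat.card G) = ∑ i, Real.log (m i) := by
    rw [← Nat.card_congr e'.toEquiv, Nat.card_pi]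
    simp only [Nat.card_zmod]
    push_cast
    exact Real.log_prod fun i _ => by
      have := hm i
      positivity
  set Λ := Real.log (Nat.card G) with hΛ
  have hG : Real.log 2 ≤ Λ :=
    Real.log_le_log two_pos (by exact_mod_cast Finite.one_lt_card)
  set r : ℝ := (3 / Real.log 2 * Λ) ^ (1 / ((k + 2 : ℕ) : ℝ)) with hr
  -- Since `r ≥ 1`, rounding up at most doubles it, and the single apex vertex can be absorbed into
  -- the factor of `q`.
  have hr1 : 1 ≤ r := by
    refine Real.one_le_rpow ?_ (by positivity)
    rw [div_mul_eq_mul_div, le_div_iff₀ hlog2]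
    linarith
  set q := ⌈r⌉₊ with hq
  have hq0 : NeZero q := ⟨(Nat.ceil_pos.2 (by linarith)).ne'⟩
  have hqr : r ≤ q := Nat.le_ceil r
  have hq2 : (q : ℝ) ≤ 2 * r := by
    have := Nat.ceil_lt_add_one (zero_le_one.trans hr1)
    linarith
  have hsum : ∑ i, (Nat.log 2 (m i) + 2) ≤ q ^ (k + 2) := by
    -- As `m i ≥ 2`, its logarithm is at least `1`, so `Nat.log 2 (m i) + 2` is at most `3 * Nat.log
    -- 2 (m i)`; this is the source of the `3`.
    have h1 : ((∑ i, (Nat.log 2 (m i) + 2) : ℕ) : ℝ) ≤ 3 / Real.log 2 * Λ := by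
      rw [hcard, Finset.mul_sum]
      push_cast
      refine Finset.sum_le_sum fun i _ => ?_
      have h2 := natCast_log_mul_log_le (m := m i) (by have := hm i; omega)
      have h3 : (1 : ℝ) ≤ Nat.log 2 (m i) := by
        exact_mod_cast Nat.log_pos one_lt_two (hm i)
      rw [div_mul_eq_mul_div, le_div_iff₀ hlog2]
      nlinarith
    have h4 : 3 / Real.log 2 * Λ = r ^ (k + 2) := by
      rw [hr, one_div, Real.rpow_inv_natCast_pow (by positivity) (by omega)]
    have h5 : r ^ (k + 2) ≤ (q : ℝ) ^ (k + 2) :=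
      pow_le_pow_left₀ (zero_le_one.trans hr1) hqr _
    exact_mod_cast (h1.trans (h4.le.trans h5))
  obtain ⟨X, ⟨f⟩⟩ := exists_cohomology_equiv_pi_zmod k q m hsum
  refine ⟨_, ⟨X, ⟨f.trans e'⟩⟩, ?_⟩
  have hsplit : r = (3 / Real.log 2) ^ (1 / ((k + 2 : ℕ) : ℝ)) *
      Λ ^ (1 / ((k + 2 : ℕ) : ℝ)) := by
    rw [hr, Real.mul_rpow (by positivity) (by linarith)]
  have hq1 : (1 : ℝ) ≤ q := hr1.trans hqr
  rw [mul_assoc, mul_assoc, ← hsplit]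
  set c : ℝ := (Fintype.card (DoublingData.Letter k) : ℝ) with hc
  calc (((k + 3) * (Fintype.card (DoublingData.Letter k) * q) + 1 : ℕ) : ℝ)
      = (k + 3) * c * q + 1 := by
        push_cast
        ring
    _ ≤ ((k + 3) * c + 1) * q := by linarith
    _ ≤ ((k + 3) * c + 1) * (2 * r) := by gcongr

theorem mainTheorem8 (d : ℕ) (hd : 2 ≤ d) :
    ∃ c C : ℝ, 0 < c ∧ 0 < C ∧
      ∀ (G : Type*) [AddCommGroup G] [Finite G],
        (cohomologyVertexCounts d G).Nonempty ∧
        c * Real.log (Nat.card G) ^ (1 / (d : ℝ)) ≤ (cohomologyVertexNumber d G : ℝ) ∧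
        (cohomologyVertexNumber d G : ℝ) ≤ C * Real.log (Nat.card G) ^ (1 / (d : ℝ)) := by
  obtain ⟨k, rfl⟩ : ∃ k, d = k + 2 := ⟨d - 2, by omega⟩
  have hlog2 : 0 < Real.log 2 := Real.log_pos one_lt_two
  set κ : ℝ := Real.log (2 * (k + 3) + 1) with hκ
  have hκ0 : 0 < κ := Real.log_pos (by
    have : (0 : ℝ) ≤ k := Nat.cast_nonneg k
    linarith)
  refine ⟨(κ ^ (1 / ((k + 2 : ℕ) : ℝ)))⁻¹,
    ((k + 3) * Fintype.card (DoublingData.Letter k) + 1) *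
      (2 * (3 / Real.log 2) ^ (1 / ((k + 2 : ℕ) : ℝ))), by positivity, by positivity, ?_⟩
  intro G _ _
  have hΛ : 0 ≤ Real.log (Nat.card G) := Real.log_natCast_nonneg _
  have hex : ∃ n ∈ cohomologyVertexCounts (k + 2) G,
      (n : ℝ) ≤ ((k + 3) * Fintype.card (DoublingData.Letter k) + 1) *
        (2 * (3 / Real.log 2) ^ (1 / ((k + 2 : ℕ) : ℝ))) *
        Real.log (Nat.card G) ^ (1 / ((k + 2 : ℕ) : ℝ)) := by
    rcases subsingleton_or_nontrivial G with h | h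
    · refine ⟨0, zero_mem_cohomologyVertexCounts, ?_⟩
      rw [Nat.cast_zero]
      positivity
    · exact exists_mem_cohomologyVertexCounts_le k G
  obtain ⟨n, hn, hle⟩ := hex
  refine ⟨⟨n, hn⟩, ?_, le_trans (by exact_mod_cast Nat.sInf_le hn) hle⟩
  have hmem : cohomologyVertexNumber (k + 2) G ∈ cohomologyVertexCounts (k + 2) G :=
    Nat.sInf_mem ⟨n, hn⟩
  have h1 := log_card_le_of_mem_cohomologyVertexCounts hmem
  rw [inv_mul_le_iff₀ (by positivity)]
  refine (Real.rpow_le_rpow hΛ h1 (by positivity)).trans (le_of_eq ?_)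
  rw [Real.mul_rpow hκ0.le (by positivity), one_div,
    Real.pow_rpow_inv_natCast (by positivity) (by omega)]
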